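/- For a function $f\in L^2(\mathbb R)$ and $s\in\mathbb R$ let $\Lambda^{s}f$ denote the Fourier multiplier operator with symbol $|\xi|^{s}$ (normalized so that $\partial_x$ has symbol $i\xi$), and let $\mathcal H f(x)=\frac1\pi\,\mathrm{PV}\!\int_{-\infty}^{\infty}\frac{f(y)}{x-y}\,dy$ be the Hilbert transform. (i) Let $0<\alpha<1$. There are constants $C_\alpha^{(1)}>0$ and $C_\alpha^{(2)}>0$, depending only on $\alpha$, such that for every even Schwartz function $g:\mathbb R\to\mathbb R$ $$\int_0^\infty \frac{\Lambda^{-\alpha}g'(x)\cdot g'(x)}{x}\,e^{-x}\,dx\;\ge\; C_\alpha^{(1)}\int_0^\infty\frac{(g(0)-g(x))^2}{x^{3-\alpha}}\,dx-C_\alpha^{(2)}\|g\|_\infty^2 .$$ (ii) Let $1\le\alpha<2$. There are constants $C_\alpha^{(3)}>0$ and $C_\alpha^{(4)}>0$, depending only on $\alpha$, such that for every even Schwartz function $g:\mathbb R\to\mathbb R$ $$-\int_0^\infty \frac{\Lambda^{-(\alpha-1)}\mathcal H g(x)\cdot g'(x)}{x}\,e^{-x}\,dx\;\ge\; C_\alpha^{(3)}\int_0^\infty\frac{(g(0)-g(x))^2}{x^{3-\alpha}}\,dx-C_\alpha^{(4)}\|g\|_\infty^2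 .$$ In both cases all the integrals over $(0,\infty)$ converge absolutely. -/

import Mathlib

open MeasureTheory Set Filter Topology
open scoped FourierTransform SchwartzMap

noncomputable section

/-- The Hilbert transform on the line,
`(H f)(x) = (1/π) PV ∫ f(y) / (x - y) dy`, the principal value being the limit as `ε → 0⁺` of the
integrals over `{y : |x - y| > ε}`. -/
def hilbertTransform (f : ℝ → ℝ) (x : ℝ) : ℝ :=
  Real.pi⁻¹ *
    limUnder (𝓝[>] (0 : ℝ)) (fun ε : ℝ => ∫ y in {y : ℝ | ε < |x - y|}, f y / (x - y))

open Classical in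
/-- The operator `Λ^s = (-Δ)^{s/2}` on the line, i.e. the Fourier multiplier with symbol `|ξ|^s`
(`ξ` the angular frequency, which is `2πξ` in Mathlib's normalization of the Fourier transform),
acting on real-valued square-integrable functions `f`:
`(Λ^s f)(x) = ∫ e^{2πixξ} |2πξ|^s f̂(ξ) dξ`, where `f̂` is the `L²` Fourier transform of `f`.
As `f` is real and the symbol is real and even, this integral is a real number, so that taking the
real part only changes its type. The value is `0` if `f` is not square-integrable. -/
def lambdaPow (s : ℝ) (f : ℝ → ℝ) (x : ℝ) : ℝ :=
  if h : MemLp (fun y : ℝ => (f y : ℂ)) 2 volume then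
    (𝓕⁻ (fun ξ : ℝ => ((|2 * Real.pi * ξ| ^ s : ℝ) : ℂ) *
      (𝓕 (h.toLp (fun y : ℝ => (f y : ℂ))) : Lp ℂ 2 (volume : Measure ℝ)) ξ) x).re
  else 0

end

/-! Put p = 2 - α, so 0 < p < 2. On the Fourier side both Λ^{-α} ∂ₓ and -Λ^{-(α-1)} H have the
symbol i sgn(ω)|ω|^{p-1}, hence both equal a positive multiple (2 κ_p)⁻¹ of Tg(x) = ∫_{t>0} (g(x+t)
- g(x-t)) t^{-p} dt, where κ_p = ∫_0^∞ sin u u^{-p} du (`fourierInv_oddSymbol_mul`,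
`lambdaPow_deriv`, `lambdaPow_hilbertTransform`). One coercivity estimate for T therefore gives both
parts.

For even g the operator folds to Tg(x) = ∫_{y>0} (g(y) - g(x)) k(x,y) dy with k(x,y) =
sgn(y-x)|y-x|^{-p} - (x+y)^{-p}. With w(x) = e^{-x}/x, the factor (g(y) - g(x)) g'(x) is -∂ₓ (g(x) -
g(y))²/2, so integrating ∫ w g' Tg by parts in x over (ε, ∞) leaves a boundary term at x = ε and a
double integral of (g(x) - g(y))²/2 against ∂ₓ(w k) (`integral_weight_mul_regOp`). As ε → 0, w(ε) ~
1/ε and k(ε,y) ~ 2εp y^{-p-1}, so the boundary term tends to p ∫ (g(0) - g(y))² y^{-p-1} dy, the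
coercive quantity.

In the double integral only the symmetrisation of ∂ₓ(w k) in (x,y) matters, and it is bounded below
by minus an integrable function (`formKernel_add_swap_ge`); this costs a multiple of ‖g‖∞². To make
every integral absolutely convergent, t^{-p} is replaced by (t+ε)^{-p} e^{-εt}, with the same ε as
the cut-off in x. This kernel remains decreasing and convex, with convex slope, and those properties
drive the pointwise bounds. -/

noncomputable section

/-! ### The regularised kernel: derivatives, monotonicity, convexity. -/

/-- The regularised kernel `(t + ε)^{-p} e^{-εt}`. -/
def kernel (p ε t : ℝ) : ℝ := (t + ε) ^ (-p) * Real.exp (-ε * t)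

/-- Minus the derivative of `kernel`. -/
def kernelSlope (p ε t : ℝ) : ℝ :=
  (p * (t + ε) ^ (-p - 1) + ε * (t + ε) ^ (-p)) * Real.exp (-ε * t)

/-- The second derivative of `kernel`. -/
def kernelCurv (p ε t : ℝ) : ℝ :=
  (p * (p + 1) * (t + ε) ^ (-p - 2) + 2 * p * ε * (t + ε) ^ (-p - 1) + ε ^ 2 * (t + ε) ^ (-p))
    * Real.exp (-ε * t)

section Kernel

variable {p ε t : ℝ}

lemma hasDerivAt_add_rpow (a : ℝ) (ht : 0 < t + ε) :
    HasDerivAt (fun t : ℝ => (t + ε) ^ a) (a * (t + ε) ^ (a - 1)) t := by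
  have h := ((hasDerivAt_id t).add_const ε).rpow_const (p := a) (Or.inl ht.ne')
  simpa using h

lemma hasDerivAt_exp_neg_mul (ε t : ℝ) :
    HasDerivAt (fun t : ℝ => Real.exp (-ε * t)) (-ε * Real.exp (-ε * t)) t := by
  have h := ((hasDerivAt_id t).const_mul (-ε)).exp
  simpa [mul_comm] using h

lemma hasDerivAt_kernel (ht : 0 < t + ε) :
    HasDerivAt (kernel p ε) (-kernelSlope p ε t) t := by
  have h := (hasDerivAt_add_rpow (-p) ht).mul (hasDerivAt_exp_neg_mul ε t)
  refine h.congr_deriv ?_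
  unfold kernelSlope; ring

lemma hasDerivAt_kernelSlope (ht : 0 < t + ε) :
    HasDerivAt (kernelSlope p ε) (-kernelCurv p ε t) t := by
  have h := (((hasDerivAt_add_rpow (-p - 1) ht).const_mul p).add
    ((hasDerivAt_add_rpow (-p) ht).const_mul ε)).mul (hasDerivAt_exp_neg_mul ε t)
  refine h.congr_deriv ?_
  unfold kernelCurv
  rw [show -p - 1 - 1 = -p - 2 by ring]
  simp only [Pi.add_apply]
  ring

lemma add_rpow_le_add_rpow {s a : ℝ} (ha : a ≤ 0) (hs : 0 < s + ε) (hst : s ≤ t) :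
    (t + ε) ^ a ≤ (s + ε) ^ a :=
  Real.rpow_le_rpow_of_nonpos hs (by linarith) ha

lemma exp_neg_mul_le {s : ℝ} (hε : 0 ≤ ε) (hst : s ≤ t) :
    Real.exp (-ε * t) ≤ Real.exp (-ε * s) := by
  apply Real.exp_le_exp.2; nlinarith

lemma kernel_nonneg (hε : 0 ≤ ε) (ht : 0 ≤ t) : 0 ≤ kernel p ε t := by
  unfold kernel; positivity

lemma kernelSlope_nonneg (hp : 0 ≤ p) (hε : 0 ≤ ε) (ht : 0 ≤ t) : 0 ≤ kernelSlope p ε t := by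
  unfold kernelSlope; positivity

lemma kernelSlope_antitone {s : ℝ} (hp : 0 ≤ p) (hε : 0 < ε) (hs : 0 ≤ s) (hst : s ≤ t) :
    kernelSlope p ε t ≤ kernelSlope p ε s := by
  unfold kernelSlope
  have h1 := add_rpow_le_add_rpow (ε := ε) (a := -p) (by linarith) (by linarith) hst
  have h3 := add_rpow_le_add_rpow (ε := ε) (a := -p - 1) (by linarith) (by linarith) hst
  have h2 := exp_neg_mul_le hε.le hst
  gcongr

lemma kernelCurv_antitone {s : ℝ} (hp : 0 ≤ p) (hε : 0 < ε) (hs : 0 ≤ s) (hst : s ≤ t) :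
    kernelCurv p ε t ≤ kernelCurv p ε s := by
  unfold kernelCurv
  have h1 := add_rpow_le_add_rpow (ε := ε) (a := -p) (by linarith) (by linarith) hst
  have h3 := add_rpow_le_add_rpow (ε := ε) (a := -p - 1) (by linarith) (by linarith) hst
  have h4 := add_rpow_le_add_rpow (ε := ε) (a := -p - 2) (by linarith) (by linarith) hst
  have h2 := exp_neg_mul_le hε.le hst
  gcongr

/-- The logarithmic derivative of the kernel is -(p/(t+ε) + ε). This controls the kernel by its
slope near the diagonal. -/
lemma kernel_le_slope (hε : 0 < ε) (ht : 0 ≤ t) :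
    p * kernel p ε t ≤ (t + ε) * kernelSlope p ε t := by
  have hpos : 0 < t + ε := by linarith
  have h : (t + ε) * (t + ε) ^ (-p - 1) = (t + ε) ^ (-p) := by
    rw [Real.rpow_sub_one hpos.ne', mul_div_cancel₀ _ hpos.ne']
  have h2 : 0 ≤ (t + ε) * (ε * (t + ε) ^ (-p)) * Real.exp (-ε * t) := by positivity
  calc p * kernel p ε t = p * ((t + ε) * (t + ε) ^ (-p - 1)) * Real.exp (-ε * t) := by
        rw [h]; unfold kernel; ring
    _ ≤ p * ((t + ε) * (t + ε) ^ (-p - 1)) * Real.exp (-ε * t) +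
        (t + ε) * (ε * (t + ε) ^ (-p)) * Real.exp (-ε * t) := by linarith
    _ = _ := by unfold kernelSlope; ring

/-- The trapezoidal rule overestimates the integral of the convex function `kernelSlope`. -/
lemma kernel_sub_le_trapezoid {x y : ℝ} (hp : 0 ≤ p) (hε : 0 < ε) (hy : 0 ≤ y) (hyx : y ≤ x) :
    kernel p ε (x - y) - kernel p ε (x + y) ≤
      y * (kernelSlope p ε (x - y) + kernelSlope p ε (x + y)) := by
  set G : ℝ → ℝ := fun y => y * (kernelSlope p ε (x - y) + kernelSlope p ε (x + y)) -
    (kernel p ε (x - y) - kernel p ε (x + y)) with hG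
  -- Differentiating the factor y produces exactly the derivative of the kernel difference, so only
  -- the curvatures remain.
  have hd : ∀ y ∈ Icc 0 x, HasDerivAt G
      (y * (kernelCurv p ε (x - y) - kernelCurv p ε (x + y))) y := by
    intro y hy
    have e1 : HasDerivAt (fun y : ℝ => x - y) (-1) y := by
      simpa using (hasDerivAt_id y).const_sub x
    have e2 : HasDerivAt (fun y : ℝ => x + y) 1 y := by
      simpa using (hasDerivAt_id y).const_add x
    have p1 : 0 < x - y + ε := by linarith [hy.2]
    have p2 : 0 < x + y + ε := by linarith [hy.1, hy.2]
    have k1 := (hasDerivAt_kernel (p := p) p1).comp y e1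
    have k2 := (hasDerivAt_kernel (p := p) p2).comp y e2
    have s1 := (hasDerivAt_kernelSlope (p := p) p1).comp y e1
    have s2 := (hasDerivAt_kernelSlope (p := p) p2).comp y e2
    refine (((hasDerivAt_id y).mul (s1.add s2)).sub (k1.sub k2)).congr_deriv ?_
    simp only [Pi.add_apply, Function.comp_apply, id]
    ring
  have hm : MonotoneOn G (Icc 0 x) := by
    refine monotoneOn_of_deriv_nonneg (convex_Icc 0 x)
      (fun y hy => (hd y hy).continuousAt.continuousWithinAt) (fun y hy => ?_) (fun y hy => ?_)
    · exact (hd y (interior_subset hy)).differentiableAt.differentiableWithinAt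
    · have hy' := interior_subset hy
      rw [(hd y hy').deriv]
      refine mul_nonneg hy'.1 (sub_nonneg.2 ?_)
      exact kernelCurv_antitone hp hε (by linarith [hy'.2]) (by linarith [hy'.1])
  have h0 := hm ⟨le_rfl, hy.trans hyx⟩ ⟨hy, hyx⟩ hy
  simp only [hG, zero_mul, sub_zero, add_zero, sub_self] at h0
  linarith

/-- A bound free of ε: the extra term from the exponential is absorbed by εt e^{-εt} ≤ 1. -/
lemma kernelSlope_le (hp : 0 ≤ p) (hε : 0 < ε) (ht : 0 < t) :
    kernelSlope p ε t ≤ (p + 1) * t ^ (-(p + 1)) := by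
  have h1 : (t + ε) ^ (-p - 1) ≤ t ^ (-(p + 1)) := by
    rw [show -(p + 1) = -p - 1 by ring]
    exact Real.rpow_le_rpow_of_nonpos ht (by linarith) (by linarith)
  have h2 : (t + ε) ^ (-p) ≤ t * t ^ (-(p + 1)) := by
    rw [show -(p + 1) = -p - 1 by ring, Real.rpow_sub_one ht.ne', mul_div_cancel₀ _ ht.ne']
    exact Real.rpow_le_rpow_of_nonpos ht (by linarith) (by linarith)
  have h3 : Real.exp (-ε * t) ≤ 1 := Real.exp_le_one_iff.2 (by nlinarith)
  have h4 : ε * t * Real.exp (-ε * t) ≤ 1 := by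
    have := Real.add_one_le_exp (ε * t)
    rw [neg_mul, Real.exp_neg, ← div_eq_mul_inv, div_le_one (Real.exp_pos _)]
    linarith
  have h5 : 0 ≤ t ^ (-(p + 1)) := by positivity
  calc kernelSlope p ε t
      ≤ (p * t ^ (-(p + 1)) + ε * (t * t ^ (-(p + 1)))) * Real.exp (-ε * t) := by
        unfold kernelSlope; gcongr
    _ = p * t ^ (-(p + 1)) * Real.exp (-ε * t) +
        t ^ (-(p + 1)) * (ε * t * Real.exp (-ε * t)) := by ring
    _ ≤ p * t ^ (-(p + 1)) * 1 + t ^ (-(p + 1)) * 1 := by gcongr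
    _ = _ := by ring

end Kernel

/-! ### The weight, the folded kernel and the pointwise bound for the symmetrised form. -/

/-- The weight `e^{-x} / x`. -/
def weight (x : ℝ) : ℝ := Real.exp (-x) / x

/-- Minus the derivative of `weight`. -/
def weightSlope (x : ℝ) : ℝ := Real.exp (-x) / x + Real.exp (-x) / x ^ 2

lemma hasDerivAt_weight {x : ℝ} (hx : x ≠ 0) : HasDerivAt weight (-weightSlope x) x := by
  have h1 : HasDerivAt (fun x : ℝ => Real.exp (-x)) (-Real.exp (-x)) x := by
    simpa using (hasDerivAt_id x).neg.exp
  refine (h1.div (hasDerivAt_id x) hx).congr_deriv ?_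
  unfold weightSlope
  simp only [id]
  field_simp
  ring

lemma weight_pos {x : ℝ} (hx : 0 < x) : 0 < weight x := by unfold weight; positivity

lemma weightSlope_pos {x : ℝ} (hx : 0 < x) : 0 < weightSlope x := by
  unfold weightSlope; positivity

/-- The odd kernel `sgn(y - x) ρ(|y - x|)` folded onto `y > 0` against even functions. -/
def foldedKernel (p ε x y : ℝ) : ℝ :=
  if x < y then kernel p ε (y - x) - kernel p ε (x + y)
  else -kernel p ε (x - y) - kernel p ε (x + y)

/-- The derivative in `x` of `weight x * foldedKernel p ε x y` off the diagonal. -/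
def formKernel (p ε x y : ℝ) : ℝ :=
  -weightSlope x * foldedKernel p ε x y +
    weight x * (kernelSlope p ε |x - y| + kernelSlope p ε (x + y))

/-- A symmetric integrable majorant for the negative part of the symmetrised `formKernel`. -/
def errorKernel (p x y : ℝ) : ℝ :=
  Real.exp (-(x / 2)) * (1 + y) ^ (-(p + 1)) + Real.exp (-(y / 2)) * (1 + x) ^ (-(p + 1))

/-- The constant in front of `errorKernel`. -/
def errorConst (p : ℝ) : ℝ := 2 * (p + 1) * ((1 + 10 / p) ^ 3 * 216)

/-- Below the diagonal both the folded kernel and the derivative of the weight are nonpositive, so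
no term has the wrong sign. Used to discard the strip y ≤ ε, which has no mirror image in x > ε. -/
lemma formKernel_nonneg {p ε x y : ℝ} (hp : 0 ≤ p) (hε : 0 < ε) (hy : 0 < y) (hyx : y ≤ x) :
    0 ≤ formKernel p ε x y := by
  have hx : 0 < x := hy.trans_le hyx
  unfold formKernel foldedKernel
  rw [if_neg (not_lt.2 hyx)]
  have h1 := kernel_nonneg (p := p) hε.le (sub_nonneg.2 hyx)
  have h2 := kernel_nonneg (p := p) hε.le (add_pos hx hy).le
  have h3 := kernelSlope_nonneg hp hε.le (abs_nonneg (x - y))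
  have h4 := kernelSlope_nonneg hp hε.le (add_pos hx hy).le
  have h5 := weightSlope_pos hx
  have h6 := weight_pos hx
  have : -weightSlope x * (-kernel p ε (x - y) - kernel p ε (x + y)) =
    weightSlope x * (kernel p ε (x - y) + kernel p ε (x + y)) := by ring
  rw [this]
  positivity

/-- Away from the diagonal 1 + x ≤ k (1 + y)(x - y). Raised to a power p + 1 ≤ 3 this costs (1 +
y)³, which half of the exponential decay pays for. -/
lemma rpow_neg_sub_le {p x y : ℝ} (hp : 0 < p) (hp2 : p < 2) (hy : 0 < y)
    (hd : p / 10 ≤ x - y) :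
    Real.exp (-y) * (x - y) ^ (-(p + 1)) ≤
      (1 + 10 / p) ^ 3 * 216 * (Real.exp (-(y / 2)) * (1 + x) ^ (-(p + 1))) := by
  set d := x - y with hdef
  have hd0 : 0 < d := lt_of_lt_of_le (by positivity) hd
  have hx : 0 < 1 + x := by linarith
  set k := 1 + 10 / p with hk
  have hk1 : 1 ≤ k := by rw [hk]; linarith [show 0 < 10 / p by positivity]
  have h1 : 1 ≤ 10 / p * d := by
    rw [div_mul_eq_mul_div, le_div_iff₀ hp]; linarith
  have h2 : 1 + x ≤ k * (1 + y) * d := by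
    have : x = y + d := by ring
    rw [this, hk]
    nlinarith [mul_pos hy hd0]
  have h3 : d⁻¹ ≤ k * (1 + y) * (1 + x)⁻¹ := by
    rw [← div_eq_mul_inv, le_div_iff₀ hx, inv_mul_le_iff₀ hd0]; linarith
  have h4 : d ^ (-(p + 1)) ≤ (k * (1 + y)) ^ (3 : ℝ) * (1 + x) ^ (-(p + 1)) := by
    rw [Real.rpow_neg hd0.le, ← Real.inv_rpow hd0.le, Real.rpow_neg hx.le, ← Real.inv_rpow hx.le]
    calc d⁻¹ ^ (p + 1) ≤ (k * (1 + y) * (1 + x)⁻¹) ^ (p + 1) :=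
          Real.rpow_le_rpow (by positivity) h3 (by linarith)
      _ = (k * (1 + y)) ^ (p + 1) * (1 + x)⁻¹ ^ (p + 1) :=
          Real.mul_rpow (by positivity) (by positivity)
      _ ≤ _ := by
          gcongr
          · nlinarith
          · linarith
  -- Cubing this gives the constant 216 = 6³.
  have h5 : (1 + y) ≤ 6 * Real.exp (y / 6) := by
    have := Real.add_one_le_exp (y / 6); linarith
  have h6 : (1 + y) ^ 3 ≤ 216 * Real.exp (y / 2) := by
    calc (1 + y) ^ 3 ≤ (6 * Real.exp (y / 6)) ^ 3 := by gcongr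
      _ = 216 * Real.exp (y / 2) := by
        rw [mul_pow, ← Real.exp_nat_mul]; norm_num; ring_nf
  have h7 : Real.exp (-y) * Real.exp (y / 2) = Real.exp (-(y / 2)) := by
    rw [← Real.exp_add]; ring_nf
  rw [show (3 : ℝ) = ((3 : ℕ) : ℝ) by norm_num, Real.rpow_natCast] at h4
  calc Real.exp (-y) * d ^ (-(p + 1))
      ≤ Real.exp (-y) * ((k * (1 + y)) ^ 3 * (1 + x) ^ (-(p + 1))) := by gcongr
    _ = Real.exp (-y) * (k ^ 3 * (1 + y) ^ 3 * (1 + x) ^ (-(p + 1))) := by ring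
    _ ≤ Real.exp (-y) * (k ^ 3 * (216 * Real.exp (y / 2)) * (1 + x) ^ (-(p + 1))) := by gcongr
    _ = k ^ 3 * 216 * ((Real.exp (-y) * Real.exp (y / 2)) * (1 + x) ^ (-(p + 1))) := by ring
    _ = _ := by rw [h7]

/-- The only negative contribution is `weightSlope y` times the kernel difference. Near the diagonal
the slope dominates the kernel; for x ≤ 1/2 the trapezoidal bound is absorbed by the two weights; in
the remaining region x - y is bounded below and the loss is integrable. -/
lemma formKernel_add_swap_ge_of_lt {p ε x y : ℝ} (hp : 0 < p) (hp2 : p < 2) (hε : 0 < ε)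
    (hεp : ε ≤ p / 10) (hy : 0 < y) (hyx : y < x) :
    -(errorConst p * errorKernel p x y) ≤ formKernel p ε x y + formKernel p ε y x := by
  have hx : 0 < x := hy.trans hyx
  have hd : 0 < x - y := sub_pos.2 hyx
  have hE : 0 ≤ errorConst p * errorKernel p x y := by
    unfold errorConst errorKernel; positivity
  have hsum : formKernel p ε x y + formKernel p ε y x =
      weightSlope x * (kernel p ε (x - y) + kernel p ε (x + y)) +
      (weight x + weight y) * (kernelSlope p ε (x - y) + kernelSlope p ε (x + y)) -
      weightSlope y * (kernel p ε (x - y) - kernel p ε (x + y)) := by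
    unfold formKernel foldedKernel
    rw [if_neg (not_lt.2 hyx.le), if_pos hyx, abs_of_pos hd, abs_sub_comm, abs_of_pos hd,
      add_comm y x]
    ring
  have k1 := kernel_nonneg (p := p) hε.le hd.le
  have k2 := kernel_nonneg (p := p) hε.le (add_pos hx hy).le
  have q1 := kernelSlope_nonneg hp.le hε.le hd.le
  have q2 := kernelSlope_nonneg hp.le hε.le (add_pos hx hy).le
  have v1 := weightSlope_pos hx
  have v2 := weightSlope_pos hy
  have w1 := weight_pos hx
  have w2 := weight_pos hy
  have a1 : 0 ≤ weightSlope x * (kernel p ε (x - y) + kernel p ε (x + y)) := by positivity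
  rw [hsum]
  -- Since `weightSlope y` = e^{-y}(1 + y)/y², this is the condition under which `kernel_le_slope`
  -- lets `weight y * kernelSlope` absorb `weightSlope y * kernel`.
  by_cases hA : (x - y + ε) * (1 + y) ≤ p * y
  · have h1 : weightSlope y * kernel p ε (x - y) ≤ weight y * kernelSlope p ε (x - y) := by
      have h2 := kernel_le_slope (p := p) hε hd.le
      have h3 : (1 + y) * kernel p ε (x - y) ≤ y * kernelSlope p ε (x - y) := by
        have h4 : p * ((1 + y) * kernel p ε (x - y)) ≤ p * (y * kernelSlope p ε (x - y)) := by
          calc p * ((1 + y) * kernel p ε (x - y)) = (1 + y) * (p * kernel p ε (x - y)) := by ring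
            _ ≤ (1 + y) * ((x - y + ε) * kernelSlope p ε (x - y)) := by gcongr
            _ = ((x - y + ε) * (1 + y)) * kernelSlope p ε (x - y) := by ring
            _ ≤ (p * y) * kernelSlope p ε (x - y) := by gcongr
            _ = _ := by ring
        exact le_of_mul_le_mul_left h4 hp
      have e1 : weightSlope y * kernel p ε (x - y) =
          Real.exp (-y) / y ^ 2 * ((1 + y) * kernel p ε (x - y)) := by
        unfold weightSlope; field_simp; ring
      have e2 : weight y * kernelSlope p ε (x - y) =
          Real.exp (-y) / y ^ 2 * (y * kernelSlope p ε (x - y)) := by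
        unfold weight; field_simp
      rw [e1, e2]
      gcongr
    have h2 : 0 ≤ weight x * (kernelSlope p ε (x - y) + kernelSlope p ε (x + y)) := by positivity
    have h3 : 0 ≤ weight y * kernelSlope p ε (x + y) := by positivity
    have h4 : 0 ≤ weightSlope y * kernel p ε (x + y) := by positivity
    nlinarith
  have htr := kernel_sub_le_trapezoid hp.le hε hy.le hyx.le
  -- After the trapezoidal bound the `weight y` part cancels against a positive term; only e^{-y}
  -- times the slopes has to be controlled.
  have hv : weightSlope y * y = Real.exp (-y) + weight y := by
    unfold weightSlope weight; field_simp
  have h1 : weightSlope y * (kernel p ε (x - y) - kernel p ε (x + y)) ≤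
      (Real.exp (-y) + weight y) * (kernelSlope p ε (x - y) + kernelSlope p ε (x + y)) := by
    rw [← hv, mul_assoc]; gcongr
  by_cases hB : x ≤ 1 / 2
  · have h2 : Real.exp (-y) ≤ weight x := by
      have e1 : Real.exp (-y) ≤ 1 := Real.exp_le_one_iff.2 (by linarith)
      have e2 : 1 ≤ weight x := by
        unfold weight
        rw [le_div_iff₀ hx]
        linarith [Real.add_one_le_exp (-x)]
      linarith
    have h3 : Real.exp (-y) * (kernelSlope p ε (x - y) + kernelSlope p ε (x + y)) ≤
        weight x * (kernelSlope p ε (x - y) + kernelSlope p ε (x + y)) := by gcongr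
    nlinarith
  -- If y ≤ 1/4 then x - y > 1/4 > p/10. Otherwise y/(1 + y) ≥ 1/5, so the failure of `hA` gives x -
  -- y + ε > p/5, and ε ≤ p/10.
  · have hdp : p / 10 ≤ x - y := by
      rcases le_total y (1 / 4) with h | h
      · linarith
      · push Not at hA
        have : p / 5 * (1 + y) ≤ p * y := by nlinarith
        have h5 : p / 5 < x - y + ε := by
          by_contra h6
          push Not at h6
          nlinarith
        linarith
    have h3 : kernelSlope p ε (x + y) ≤ kernelSlope p ε (x - y) :=
      kernelSlope_antitone hp.le hε hd.le (by linarith)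
    have h4 := kernelSlope_le hp.le hε hd
    have h5 := rpow_neg_sub_le hp hp2 hy hdp
    have h6 : Real.exp (-y) * (kernelSlope p ε (x - y) + kernelSlope p ε (x + y)) ≤
        errorConst p * errorKernel p x y := by
      calc Real.exp (-y) * (kernelSlope p ε (x - y) + kernelSlope p ε (x + y))
          ≤ Real.exp (-y) * (2 * ((p + 1) * (x - y) ^ (-(p + 1)))) := by gcongr; linarith
        _ = 2 * (p + 1) * (Real.exp (-y) * (x - y) ^ (-(p + 1))) := by ring
        _ ≤ 2 * (p + 1) *
            ((1 + 10 / p) ^ 3 * 216 * (Real.exp (-(y / 2)) * (1 + x) ^ (-(p + 1)))) := by gcongr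
        _ = errorConst p * (0 + Real.exp (-(y / 2)) * (1 + x) ^ (-(p + 1))) := by
            unfold errorConst; ring
        _ ≤ errorConst p * errorKernel p x y := by
            unfold errorKernel
            have : 0 ≤ errorConst p := by unfold errorConst; positivity
            gcongr
            positivity
    have h7 : 0 ≤ weight x * (kernelSlope p ε (x - y) + kernelSlope p ε (x + y)) := by positivity
    nlinarith

lemma errorKernel_comm (p x y : ℝ) : errorKernel p x y = errorKernel p y x := by
  unfold errorKernel; ring

lemma formKernel_add_swap_ge {p ε x y : ℝ} (hp : 0 < p) (hp2 : p < 2) (hε : 0 < ε)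
    (hεp : ε ≤ p / 10) (hx : 0 < x) (hy : 0 < y) :
    -(errorConst p * errorKernel p x y) ≤ formKernel p ε x y + formKernel p ε y x := by
  rcases lt_trichotomy x y with h | h | h
  · rw [errorKernel_comm, add_comm]
    exact formKernel_add_swap_ge_of_lt hp hp2 hε hεp hx h
  · subst h
    have h1 := formKernel_nonneg hp.le hε hx (le_refl x)
    have hE : 0 ≤ errorConst p * errorKernel p x x := by
      unfold errorConst errorKernel; positivity
    linarith
  · exact formKernel_add_swap_ge_of_lt hp hp2 hε hεp hy h

/-! ### Measurability and ε-dependent exponential bounds. -/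

lemma measurable_kernel (p ε : ℝ) : Measurable (kernel p ε) := by
  unfold kernel; fun_prop

lemma measurable_foldedKernel (p ε : ℝ) :
    Measurable (fun z : ℝ × ℝ => foldedKernel p ε z.1 z.2) := by
  unfold foldedKernel kernel
  refine Measurable.ite (measurableSet_lt measurable_fst measurable_snd) ?_ ?_ <;> fun_prop

lemma measurable_weight : Measurable weight := by unfold weight; fun_prop

lemma measurable_formKernel (p ε : ℝ) :
    Measurable (fun z : ℝ × ℝ => formKernel p ε z.1 z.2) := by
  have := measurable_foldedKernel p ε
  unfold formKernel weightSlope weight kernelSlope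
  fun_prop

section Bounds

variable {p ε : ℝ}

lemma kernel_le_exp {t : ℝ} (hp : 0 ≤ p) (hε : 0 < ε) (ht : 0 ≤ t) :
    kernel p ε t ≤ ε ^ (-p) * Real.exp (-ε * t) := by
  have h1 : (t + ε) ^ (-p) ≤ ε ^ (-p) :=
    Real.rpow_le_rpow_of_nonpos hε (by linarith) (by linarith)
  unfold kernel
  gcongr

lemma kernelSlope_le_exp {t : ℝ} (hp : 0 ≤ p) (hε : 0 < ε) (ht : 0 ≤ t) :
    kernelSlope p ε t ≤ (p * ε ^ (-p - 1) + ε * ε ^ (-p)) * Real.exp (-ε * t) := by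
  unfold kernelSlope
  have h1 : (t + ε) ^ (-p) ≤ ε ^ (-p) :=
    Real.rpow_le_rpow_of_nonpos hε (by linarith) (by linarith)
  have h2 : (t + ε) ^ (-p - 1) ≤ ε ^ (-p - 1) :=
    Real.rpow_le_rpow_of_nonpos hε (by linarith) (by linarith)
  gcongr

lemma integrableOn_kernel (hp : 0 ≤ p) (hε : 0 < ε) : IntegrableOn (kernel p ε) (Ioi 0) := by
  refine Integrable.mono' ((exp_neg_integrableOn_Ioi 0 hε).const_mul (ε ^ (-p)))
    (measurable_kernel p ε).aestronglyMeasurable ?_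
  filter_upwards [ae_restrict_mem measurableSet_Ioi] with t ht
  rw [Real.norm_of_nonneg (kernel_nonneg hε.le (le_of_lt ht))]
  exact kernel_le_exp hp hε (le_of_lt ht)

lemma abs_foldedKernel_le {x y : ℝ} (hp : 0 ≤ p) (hε : 0 < ε) (hx : 0 < x) (hy : 0 < y) :
    |foldedKernel p ε x y| ≤ 2 * ε ^ (-p) * (Real.exp (ε * x) * Real.exp (-ε * y)) := by
  have key : ∀ t, 0 ≤ t → y - x ≤ t →
      kernel p ε t ≤ ε ^ (-p) * (Real.exp (ε * x) * Real.exp (-ε * y)) := by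
    intro t ht hyx
    refine (kernel_le_exp hp hε ht).trans ?_
    gcongr
    rw [← Real.exp_add]
    apply Real.exp_le_exp.2
    nlinarith
  have h2 := key (x + y) (by linarith) (by linarith)
  have h2' := kernel_nonneg (p := p) hε.le (add_pos hx hy).le
  unfold foldedKernel
  split_ifs with h
  · have h1 := key (y - x) (by linarith) le_rfl
    have h1' := kernel_nonneg (p := p) hε.le (sub_pos.2 h).le
    rw [abs_le]; constructor <;> linarith
  · have h1 := key (x - y) (by linarith) (by linarith)
    have h1' := kernel_nonneg (p := p) hε.le (sub_nonneg.2 (not_lt.1 h))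
    rw [abs_le]; constructor <;> linarith

lemma weight_le {x : ℝ} (hε : 0 < ε) (hx : ε ≤ x) : weight x ≤ ε⁻¹ * Real.exp (-x) := by
  unfold weight
  rw [div_eq_inv_mul]
  gcongr

lemma weightSlope_le {x : ℝ} (hε : 0 < ε) (hx : ε ≤ x) :
    weightSlope x ≤ (ε⁻¹ + (ε ^ 2)⁻¹) * Real.exp (-x) := by
  unfold weightSlope
  rw [div_eq_inv_mul, div_eq_inv_mul, ← add_mul]
  gcongr

lemma exp_neg_mul_exp_le {x y : ℝ} (hε2 : ε ≤ 1 / 2) (hx : 0 ≤ x) :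
    Real.exp (-x) * (Real.exp (ε * x) * Real.exp (-ε * y)) ≤
      Real.exp (-(1 / 2) * x) * Real.exp (-ε * y) := by
  rw [← mul_assoc]
  gcongr
  rw [← Real.exp_add]
  apply Real.exp_le_exp.2
  nlinarith

/-- The constant degenerates as ε → 0. The bound serves qualitative purposes at fixed ε:
integrability, Fubini, vanishing at infinity and the derivative on the diagonal. -/
lemma exists_abs_kernels_le (hp : 0 ≤ p) (hε : 0 < ε) (hε2 : ε ≤ 1 / 2) :
    ∃ C : ℝ, 0 ≤ C ∧ ∀ x y : ℝ, ε ≤ x → 0 < y →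
      |weight x * foldedKernel p ε x y| ≤ C * (Real.exp (-(1 / 2) * x) * Real.exp (-ε * y)) ∧
      |formKernel p ε x y| ≤ C * (Real.exp (-(1 / 2) * x) * Real.exp (-ε * y)) := by
  set A := 2 * ε ^ (-p)
  set B := ε⁻¹
  set B' := ε⁻¹ + (ε ^ 2)⁻¹
  set D := p * ε ^ (-p - 1) + ε * ε ^ (-p)
  have hA : 0 ≤ A := by positivity
  have hB : 0 ≤ B := by positivity
  have hB' : 0 ≤ B' := by positivity
  have hD : 0 ≤ D := by positivity
  refine ⟨B * A + B' * A + B * (2 * D), by positivity, fun x y hx hy => ?_⟩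
  have hx0 : 0 < x := hε.trans_le hx
  set e := Real.exp (ε * x) * Real.exp (-ε * y)
  have he : 0 ≤ e := by positivity
  have hE := exp_neg_mul_exp_le (y := y) hε2 hx0.le
  set E := Real.exp (-(1 / 2) * x) * Real.exp (-ε * y)
  have hE0 : 0 ≤ E := by positivity
  have hm := abs_foldedKernel_le hp hε hx0 hy
  have hw := weight_le hε hx
  have hv := weightSlope_le hε hx
  have w0 := weight_pos hx0
  have v0 := weightSlope_pos hx0
  have b1 : |weight x * foldedKernel p ε x y| ≤ B * A * E := by
    rw [abs_mul, abs_of_pos w0]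
    calc weight x * |foldedKernel p ε x y| ≤ (B * Real.exp (-x)) * (A * e) := by gcongr
      _ = B * A * (Real.exp (-x) * e) := by ring
      _ ≤ B * A * E := by gcongr
  have b2 : |-weightSlope x * foldedKernel p ε x y| ≤ B' * A * E := by
    rw [abs_mul, abs_neg, abs_of_pos v0]
    calc weightSlope x * |foldedKernel p ε x y| ≤ (B' * Real.exp (-x)) * (A * e) := by gcongr
      _ = B' * A * (Real.exp (-x) * e) := by ring
      _ ≤ B' * A * E := by gcongr
  have key : ∀ t, 0 ≤ t → y - x ≤ t → |kernelSlope p ε t| ≤ D * e := by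
    intro t ht hyx
    rw [abs_of_nonneg (kernelSlope_nonneg hp hε.le ht)]
    refine (kernelSlope_le_exp hp hε ht).trans ?_
    simp only [e, D]
    gcongr
    rw [← Real.exp_add]
    apply Real.exp_le_exp.2
    nlinarith
  have b3 : |weight x * (kernelSlope p ε |x - y| + kernelSlope p ε (x + y))| ≤
      B * (2 * D) * E := by
    have k1 := key |x - y| (abs_nonneg _) (by linarith [neg_abs_le (x - y)])
    have k2 := key (x + y) (by linarith) (by linarith)
    have k3 := (abs_add_le (kernelSlope p ε |x - y|) (kernelSlope p ε (x + y)))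
    rw [abs_mul, abs_of_pos w0]
    calc weight x * |kernelSlope p ε |x - y| + kernelSlope p ε (x + y)|
        ≤ (B * Real.exp (-x)) * (2 * D * e) := by gcongr; linarith
      _ = B * (2 * D) * (Real.exp (-x) * e) := by ring
      _ ≤ B * (2 * D) * E := by gcongr
  have p1 : 0 ≤ B * A * E := by positivity
  have p2 : 0 ≤ B' * A * E := by positivity
  have p3 : 0 ≤ B * (2 * D) * E := by positivity
  refine ⟨by linarith, ?_⟩
  unfold formKernel
  refine (abs_add_le _ _).trans ?_
  linarith

end Bounds

/-! ### Folding the regularised operator onto the half-line. -/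

lemma setIntegral_Ioi_add_left (F : ℝ → ℝ) (a b : ℝ) :
    ∫ t in Ioi b, F (a + t) = ∫ y in Ioi (a + b), F y := by
  have h := (measurePreserving_add_left (volume : Measure ℝ) a).setIntegral_preimage_emb
    (measurableEmbedding_addLeft a) F (Ioi (a + b))
  rw [← h]
  congr 2
  ext t; simp

lemma integrableOn_Ioi_add_left {F : ℝ → ℝ} {a b : ℝ} :
    IntegrableOn (fun t => F (a + t)) (Ioi b) ↔ IntegrableOn F (Ioi (a + b)) := by
  have h := (measurePreserving_add_left (volume : Measure ℝ) a).integrableOn_comp_preimage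
    (measurableEmbedding_addLeft a) (f := F) (s := Ioi (a + b))
  rw [← h]
  have : (fun x => a + x) ⁻¹' Ioi (a + b) = Ioi b := by ext t; simp
  rw [this]; rfl

lemma setIntegral_Ioo_sub_left (F : ℝ → ℝ) (a : ℝ) :
    ∫ t in Ioo 0 a, F (a - t) = ∫ y in Ioo 0 a, F y := by
  have h := (Measure.measurePreserving_sub_left (volume : Measure ℝ) a).setIntegral_preimage_emb
    (measurableEmbedding_subLeft a) F (Ioo 0 a)
  rw [← h]
  congr 2
  ext t; simp [and_comm]

lemma integrable_mul_kernel {p ε B : ℝ} (hp : 0 ≤ p) (hε : 0 < ε) {f : ℝ → ℝ} (hf : Measurable f)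
    (hB : ∀ x, |f x| ≤ B) : IntegrableOn (fun t => f t * kernel p ε t) (Ioi 0) :=
  (integrableOn_kernel hp hε).bdd_mul hf.aestronglyMeasurable (Eventually.of_forall hB)

/-- Integration of an even function against `foldedKernel`. -/
lemma integral_mul_foldedKernel {p ε x B : ℝ} (hp : 0 ≤ p) (hε : 0 < ε) (hx : 0 < x) {f : ℝ → ℝ}
    (hf : Measurable f) (hB : ∀ x, |f x| ≤ B) (hev : ∀ x, f (-x) = f x) :
    ∫ y in Ioi 0, f y * foldedKernel p ε x y =
      ∫ t in Ioi 0, (f (x + t) - f (x - t)) * kernel p ε t := by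
  have i1 : IntegrableOn (fun t => f (x + t) * kernel p ε t) (Ioi 0) :=
    integrable_mul_kernel hp hε (by fun_prop) (fun t => hB _)
  have i2 : IntegrableOn (fun t => f (x - t) * kernel p ε t) (Ioi 0) :=
    integrable_mul_kernel hp hε (by fun_prop) (fun t => hB _)
  have j1 : IntegrableOn (fun y => f y * kernel p ε (y - x)) (Ioi x) := by
    have := (integrableOn_Ioi_add_left (F := fun y => f y * kernel p ε (y - x)) (a := x)
      (b := 0)).1 (by simpa using i1)
    simpa using this
  -- Substitution on three pieces: y = x + t covers y > x, y = x - t covers 0 < y < x, and for t > x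
  -- evenness replaces f(x - t) by f(t - x), producing the kernel in x + y.
  have e1 : ∫ t in Ioi 0, f (x + t) * kernel p ε t = ∫ y in Ioi x, f y * kernel p ε (y - x) := by
    have := setIntegral_Ioi_add_left (fun y => f y * kernel p ε (y - x)) x 0
    simpa using this
  have j2 : IntegrableOn (fun y => f y * kernel p ε (x + y)) (Ioi 0) := by
    rw [← add_zero x] at i2
    have := (integrableOn_Ioi_add_left (F := fun t => f (x - t) * kernel p ε t) (a := x)
      (b := 0)).2 (i2.mono_set (Ioi_subset_Ioi (by simpa using hx.le)) |>.congr_fun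
        (fun t _ => by simp) measurableSet_Ioi)
    simpa [hev] using this
  have e2 : ∫ t in Ioi x, f (x - t) * kernel p ε t = ∫ y in Ioi 0, f y * kernel p ε (x + y) := by
    have := setIntegral_Ioi_add_left (fun t => f (x - t) * kernel p ε t) x 0
    simpa [hev] using this.symm
  have e3 : ∫ t in Ioo 0 x, f (x - t) * kernel p ε t =
      ∫ y in Ioo 0 x, f y * kernel p ε (x - y) := by
    have := setIntegral_Ioo_sub_left (fun y => f y * kernel p ε (x - y)) x
    simpa using this
  have hsplit : Ioi (0 : ℝ) = Ioc 0 x ∪ Ioi x := (Ioc_union_Ioi_eq_Ioi hx.le).symm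
  have hdisj : Disjoint (Ioc 0 x) (Ioi x) := Ioc_disjoint_Ioi_same
  have e4 : ∫ t in Ioi 0, f (x - t) * kernel p ε t =
      (∫ y in Ioc 0 x, f y * kernel p ε (x - y)) + ∫ y in Ioi 0, f y * kernel p ε (x + y) := by
    rw [hsplit, setIntegral_union hdisj measurableSet_Ioi
      (i2.mono_set (by rw [hsplit]; exact subset_union_left))
      (i2.mono_set (by rw [hsplit]; exact subset_union_right)), e2, integral_Ioc_eq_integral_Ioo,
      e3, integral_Ioc_eq_integral_Ioo, ← hsplit]
  have i3 : IntegrableOn (fun y => f y * kernel p ε (x - y)) (Ioc 0 x) := by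
    refine Integrable.mono' (integrable_const (B * ε ^ (-p)))
      (hf.mul ((measurable_kernel p ε).comp (measurable_const.sub measurable_id))
        ).aestronglyMeasurable ?_
    filter_upwards [ae_restrict_mem measurableSet_Ioc] with y hy
    have h1 := kernel_nonneg (p := p) hε.le (sub_nonneg.2 hy.2)
    have h2 : kernel p ε (x - y) ≤ ε ^ (-p) := by
      refine (kernel_le_exp hp hε (sub_nonneg.2 hy.2)).trans ?_
      refine mul_le_of_le_one_right (by positivity) (Real.exp_le_one_iff.2 ?_)
      nlinarith [hy.2]
    rw [norm_mul, Real.norm_eq_abs, Real.norm_of_nonneg h1]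
    have := hB y
    have h3 : 0 ≤ B := (abs_nonneg _).trans this
    gcongr
  have L1 : ∫ y in Ioc 0 x, f y * foldedKernel p ε x y =
      -(∫ y in Ioc 0 x, f y * kernel p ε (x - y)) - ∫ y in Ioc 0 x, f y * kernel p ε (x + y) := by
    rw [← integral_neg, ← integral_sub (Integrable.fun_neg i3) (j2.mono_set Ioc_subset_Ioi_self)]
    refine setIntegral_congr_fun measurableSet_Ioc (fun y hy => ?_)
    simp only [foldedKernel, if_neg (not_lt.2 hy.2)]
    ring
  have L2 : ∫ y in Ioi x, f y * foldedKernel p ε x y =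
      (∫ y in Ioi x, f y * kernel p ε (y - x)) - ∫ y in Ioi x, f y * kernel p ε (x + y) := by
    rw [← integral_sub j1 (j2.mono_set (Ioi_subset_Ioi hx.le))]
    refine setIntegral_congr_fun measurableSet_Ioi (fun y hy => ?_)
    simp only [foldedKernel, if_pos (mem_Ioi.1 hy)]
    ring
  have L1i : IntegrableOn (fun y => f y * foldedKernel p ε x y) (Ioc 0 x) := by
    refine (i3.neg.sub (j2.mono_set Ioc_subset_Ioi_self)).congr_fun (fun y hy => ?_)
      measurableSet_Ioc
    simp only [foldedKernel, if_neg (not_lt.2 hy.2), Pi.sub_apply, Pi.neg_apply]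
    ring
  have L2i : IntegrableOn (fun y => f y * foldedKernel p ε x y) (Ioi x) := by
    refine (j1.sub (j2.mono_set (Ioi_subset_Ioi hx.le))).congr_fun (fun y hy => ?_)
      measurableSet_Ioi
    simp only [foldedKernel, if_pos (mem_Ioi.1 hy), Pi.sub_apply]
    ring
  have j2s : ∫ y in Ioi 0, f y * kernel p ε (x + y) = (∫ y in Ioc 0 x, f y * kernel p ε (x + y)) +
      ∫ y in Ioi x, f y * kernel p ε (x + y) := by
    rw [hsplit, setIntegral_union hdisj measurableSet_Ioi
      (j2.mono_set Ioc_subset_Ioi_self) (j2.mono_set (Ioi_subset_Ioi hx.le))]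
  have R : ∫ t in Ioi 0, (f (x + t) - f (x - t)) * kernel p ε t =
      (∫ t in Ioi 0, f (x + t) * kernel p ε t) - ∫ t in Ioi 0, f (x - t) * kernel p ε t := by
    rw [← integral_sub i1 i2]; simp only [sub_mul]
  rw [R, e1, e4, j2s]
  nth_rewrite 1 [hsplit]
  rw [setIntegral_union hdisj measurableSet_Ioi L1i L2i, L1, L2]
  ring

/-! ### Integration by parts in x at fixed ε. -/

/-- The boundary function in the integration by parts. -/
def boundaryTerm (p ε : ℝ) (g : ℝ → ℝ) (x y : ℝ) : ℝ :=
  weight x * foldedKernel p ε x y * ((g x - g y) ^ 2 / 2)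

lemma hasDerivAt_foldedKernel {p ε x y : ℝ} (hε : 0 < ε) (hx : 0 < x) (hy : 0 < y) (hxy : x ≠ y) :
    HasDerivAt (fun x => foldedKernel p ε x y)
      (kernelSlope p ε |x - y| + kernelSlope p ε (x + y)) x := by
  have e2 : HasDerivAt (fun x : ℝ => x + y) 1 x := by
    simpa using (hasDerivAt_id x).add_const y
  have k2 := (hasDerivAt_kernel (p := p) (show 0 < x + y + ε by linarith)).comp x e2
  rcases lt_or_gt_of_ne hxy with h | h
  · have e1 : HasDerivAt (fun x : ℝ => y - x) (-1) x := by
      simpa using (hasDerivAt_id x).const_sub y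
    have k1 := (hasDerivAt_kernel (p := p) (show 0 < y - x + ε by linarith)).comp x e1
    rw [abs_sub_comm, abs_of_pos (sub_pos.2 h)]
    refine ((k1.sub k2).congr_of_eventuallyEq ?_).congr_deriv (by ring)
    filter_upwards [eventually_lt_nhds h] with z hz
    simp [foldedKernel, hz]
  · have e1 : HasDerivAt (fun x : ℝ => x - y) 1 x := by
      simpa using (hasDerivAt_id x).sub_const y
    have k1 := (hasDerivAt_kernel (p := p) (show 0 < x - y + ε by linarith)).comp x e1
    rw [abs_of_pos (sub_pos.2 h)]
    refine ((k1.neg.sub k2).congr_of_eventuallyEq ?_).congr_deriv (by ring)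
    filter_upwards [eventually_gt_nhds h] with z hz
    simp [foldedKernel, not_lt.2 hz.le]

lemma abs_sub_le_of_deriv {g g' : ℝ → ℝ} {L : ℝ} (hg : ∀ x, HasDerivAt g (g' x) x)
    (hL : ∀ x, |g' x| ≤ L) (x y : ℝ) : |g x - g y| ≤ L * |x - y| := by
  have := convex_univ.norm_image_sub_le_of_norm_hasDerivWithin_le (f := g) (f' := g')
    (fun x _ => (hg x).hasDerivWithinAt) (fun x _ => hL x) (mem_univ y) (mem_univ x)
  simpa using this

/-- At x = y the folded kernel jumps, but it is bounded and multiplies a square that is O((x - y)²),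
so the derivative exists there and is zero. Integration by parts thus crosses the diagonal without a
contribution. -/
lemma hasDerivAt_boundaryTerm {p ε x y L : ℝ} {g g' : ℝ → ℝ} (hp : 0 ≤ p) (hε : 0 < ε)
    (hε2 : ε ≤ 1 / 2) (hg : ∀ x, HasDerivAt g (g' x) x) (hL : ∀ x, |g' x| ≤ L) (hx : ε < x)
    (hy : 0 < y) :
    HasDerivAt (fun x => boundaryTerm p ε g x y)
      (weight x * foldedKernel p ε x y * ((g x - g y) * g' x) +
        (g x - g y) ^ 2 / 2 * formKernel p ε x y) x := by
  have hx0 : 0 < x := hε.trans hx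
  by_cases hxy : x = y
  · subst hxy
    simp only [sub_self, zero_mul, mul_zero, add_zero, ne_eq, OfNat.ofNat_ne_zero,
      not_false_eq_true, zero_pow, zero_div]
    obtain ⟨C, hC0, hC⟩ := exists_abs_kernels_le hp hε hε2
    have hb : (fun z => boundaryTerm p ε g z x) =O[𝓝 x] (fun z => (z - x) ^ 2) := by
      refine Asymptotics.IsBigO.of_bound (C * (L ^ 2 / 2)) ?_
      filter_upwards [eventually_gt_nhds hx] with z hz
      have h1 := (hC z x hz.le hy).1
      have h2 : Real.exp (-(1 / 2) * z) * Real.exp (-ε * x) ≤ 1 := by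
        rw [← Real.exp_add]
        refine Real.exp_le_one_iff.2 ?_
        nlinarith
      have h3 := abs_sub_le_of_deriv hg hL z x
      have h4 : (g z - g x) ^ 2 ≤ L ^ 2 * (z - x) ^ 2 := by
        rw [← sq_abs, ← sq_abs (z - x), ← mul_pow]
        gcongr
      have h5 : |weight z * foldedKernel p ε z x| ≤ C := h1.trans (mul_le_of_le_one_right hC0 h2)
      rw [boundaryTerm, norm_mul, Real.norm_eq_abs, Real.norm_eq_abs, Real.norm_eq_abs,
        abs_of_nonneg (show 0 ≤ (g z - g x) ^ 2 / 2 by positivity),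
        abs_of_nonneg (sq_nonneg (z - x))]
      calc |weight z * foldedKernel p ε z x| * ((g z - g x) ^ 2 / 2)
          ≤ C * (L ^ 2 * (z - x) ^ 2 / 2) := by gcongr
        _ = _ := by ring
    rw [hasDerivAt_iff_isLittleO]
    have h0 : boundaryTerm p ε g x x = 0 := by simp [boundaryTerm]
    simp only [h0, sub_zero, smul_zero]
    refine hb.trans_isLittleO ?_
    simpa using (Asymptotics.isLittleO_pow_sub_sub x one_lt_two)
  · have h1 := (hasDerivAt_weight hx0.ne').mul (hasDerivAt_foldedKernel (p := p) hε hx0 hy hxy)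
    have h2 := ((((hg x).sub_const (g y)).pow 2).div_const 2)
    refine (h1.mul h2).congr_deriv ?_
    simp only [formKernel, Pi.mul_apply, Pi.pow_apply]
    push_cast
    ring

/-- The regularised operator `∫_{t>0} (g(x+t) - g(x-t)) ρ(t) dt`. -/
def regOp (p ε : ℝ) (g : ℝ → ℝ) (x : ℝ) : ℝ :=
  ∫ t in Ioi 0, (g (x + t) - g (x - t)) * kernel p ε t

section Identity

variable {p ε M L : ℝ} {g g' : ℝ → ℝ}

lemma integrableOn_exp_mul_exp (hε : 0 < ε) :
    IntegrableOn (fun z : ℝ × ℝ => Real.exp (-(1 / 2) * z.1) * Real.exp (-ε * z.2))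
      (Ioi ε ×ˢ Ioi 0) (volume.prod volume) := by
  rw [IntegrableOn, ← Measure.prod_restrict]
  exact (exp_neg_integrableOn_Ioi ε (by norm_num)).integrable.mul_prod
    (exp_neg_integrableOn_Ioi 0 hε).integrable

lemma abs_sub_le_two_mul (hM : ∀ x, |g x| ≤ M) (x y : ℝ) : |g x - g y| ≤ 2 * M := by
  have := abs_sub (g x) (g y)
  linarith [hM x, hM y]

lemma sq_sub_le (hM : ∀ x, |g x| ≤ M) (x y : ℝ) : (g x - g y) ^ 2 ≤ 4 * M ^ 2 := by
  have h := abs_sub_le_two_mul hM x y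
  rw [← sq_abs]
  calc |g x - g y| ^ 2 ≤ (2 * M) ^ 2 := by gcongr
    _ = _ := by ring

lemma integrableOn_transport (hp : 0 ≤ p) (hε : 0 < ε) (hε2 : ε ≤ 1 / 2)
    (hgm : Measurable g) (hg'm : Measurable g') (hM : ∀ x, |g x| ≤ M) (hL : ∀ x, |g' x| ≤ L) :
    IntegrableOn (fun z : ℝ × ℝ =>
      weight z.1 * foldedKernel p ε z.1 z.2 * ((g z.1 - g z.2) * g' z.1))
      (Ioi ε ×ˢ Ioi 0) (volume.prod volume) := by
  obtain ⟨C, hC0, hC⟩ := exists_abs_kernels_le hp hε hε2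
  refine Integrable.mono' ((integrableOn_exp_mul_exp hε).const_mul (C * (2 * M * L))) ?_ ?_
  · have := measurable_foldedKernel p ε
    have := measurable_weight
    exact Measurable.aestronglyMeasurable (by fun_prop)
  · filter_upwards [ae_restrict_mem (measurableSet_Ioi.prod measurableSet_Ioi)] with z hz
    have h1 := (hC z.1 z.2 (le_of_lt hz.1) hz.2).1
    have h2 := abs_sub_le_two_mul hM z.1 z.2
    have h3 := hL z.1
    have hM0 : 0 ≤ M := (abs_nonneg _).trans (hM 0)
    rw [Real.norm_eq_abs, abs_mul, abs_mul (_ - _)]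
    calc _ ≤ C * (Real.exp (-(1 / 2) * z.1) * Real.exp (-ε * z.2)) * (2 * M * L) := by gcongr
      _ = _ := by ring

lemma integrableOn_form (hp : 0 ≤ p) (hε : 0 < ε) (hε2 : ε ≤ 1 / 2)
    (hgm : Measurable g) (hM : ∀ x, |g x| ≤ M) :
    IntegrableOn (fun z : ℝ × ℝ => (g z.1 - g z.2) ^ 2 / 2 * formKernel p ε z.1 z.2)
      (Ioi ε ×ˢ Ioi 0) (volume.prod volume) := by
  obtain ⟨C, hC0, hC⟩ := exists_abs_kernels_le hp hε hε2
  refine Integrable.mono' ((integrableOn_exp_mul_exp hε).const_mul (C * (4 * M ^ 2 / 2))) ?_ ?_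
  · have := measurable_formKernel p ε
    exact Measurable.aestronglyMeasurable (by fun_prop)
  · filter_upwards [ae_restrict_mem (measurableSet_Ioi.prod measurableSet_Ioi)] with z hz
    have h1 := (hC z.1 z.2 (le_of_lt hz.1) hz.2).2
    have h2 := sq_sub_le hM z.1 z.2
    rw [Real.norm_eq_abs, abs_mul, abs_of_nonneg (by positivity)]
    calc _ ≤ (4 * M ^ 2 / 2) * (C * (Real.exp (-(1 / 2) * z.1) * Real.exp (-ε * z.2))) := by gcongr
      _ = _ := by ring

lemma tendsto_boundaryTerm (hp : 0 ≤ p) (hε : 0 < ε) (hε2 : ε ≤ 1 / 2)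
    (hM : ∀ x, |g x| ≤ M) {y : ℝ} (hy : 0 < y) :
    Tendsto (fun x => boundaryTerm p ε g x y) atTop (𝓝 0) := by
  obtain ⟨C, hC0, hC⟩ := exists_abs_kernels_le hp hε hε2
  have hlim : Tendsto (fun x : ℝ => C * (Real.exp (-(1 / 2) * x) * Real.exp (-ε * y)) *
      (4 * M ^ 2 / 2)) atTop (𝓝 0) := by
    have h : Tendsto (fun x : ℝ => Real.exp (-(1 / 2) * x)) atTop (𝓝 0) :=
      Real.tendsto_exp_atBot.comp (tendsto_id.const_mul_atTop_of_neg (by norm_num))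
    simpa using ((h.mul_const (Real.exp (-ε * y))).const_mul C).mul_const (4 * M ^ 2 / 2)
  refine squeeze_zero_norm' ?_ hlim
  filter_upwards [eventually_ge_atTop ε] with x hx
  have h1 := (hC x y hx hy).1
  have h2 := sq_sub_le hM x y
  rw [boundaryTerm, Real.norm_eq_abs, abs_mul,
    abs_of_nonneg (show 0 ≤ (g x - g y) ^ 2 / 2 by positivity)]
  gcongr

lemma continuousAt_boundaryTerm (hε : 0 < ε) {y : ℝ} (hy : 0 < y) (hyε : y ≠ ε)
    (hg : Continuous g) : ContinuousAt (fun x => boundaryTerm p ε g x y) ε := by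
  have h1 := (hasDerivAt_weight hε.ne').continuousAt
  have h2 := (hasDerivAt_foldedKernel (p := p) hε hε hy hyε.symm).continuousAt
  have h3 := hg.continuousAt (x := ε)
  unfold boundaryTerm
  fun_prop

/-- The quadratic form of the regularised operator, integrated by parts in `x`. -/
lemma integral_weight_mul_regOp (hp : 0 ≤ p) (hε : 0 < ε) (hε2 : ε ≤ 1 / 2)
    (hg : ∀ x, HasDerivAt g (g' x) x) (hg'm : Measurable g') (hM : ∀ x, |g x| ≤ M)
    (hL : ∀ x, |g' x| ≤ L) (hev : ∀ x, g (-x) = g x) :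
    ∫ x in Ioi ε, weight x * g' x * regOp p ε g x =
      (∫ y in Ioi 0, boundaryTerm p ε g ε y) +
      ∫ z in Ioi ε ×ˢ Ioi 0, (g z.1 - g z.2) ^ 2 / 2 * formKernel p ε z.1 z.2
        ∂(volume.prod volume) := by
  have hgc : Continuous g := continuous_iff_continuousAt.2 fun x => (hg x).continuousAt
  have I1 := integrableOn_transport hp hε hε2 hgc.measurable hg'm hM hL
  have I2 := integrableOn_form hp hε hε2 hgc.measurable hM
  have I12 := I1.add I2
  have e1 : ∫ x in Ioi ε, weight x * g' x * regOp p ε g x =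
      -∫ z in Ioi ε ×ˢ Ioi 0, weight z.1 * foldedKernel p ε z.1 z.2 * ((g z.1 - g z.2) * g' z.1)
        ∂(volume.prod volume) := by
    rw [setIntegral_prod _ I1, ← integral_neg]
    refine setIntegral_congr_fun measurableSet_Ioi (fun x hx => ?_)
    have hx0 : 0 < x := hε.trans hx
    -- Subtracting the constant g(x) changes neither evenness nor the differences g(x + t) - g(x -
    -- t).
    have h := integral_mul_foldedKernel hp hε hx0 (f := fun y => g y - g x)
      (hgc.measurable.sub_const _) (fun y => abs_sub_le_two_mul hM y x) (fun y => by simp [hev])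
    simp only [sub_sub_sub_cancel_right] at h
    simp only [regOp]
    rw [← h, ← integral_const_mul, ← integral_neg]
    refine integral_congr_ae (Eventually.of_forall fun y => ?_)
    simp only
    ring
  have e2 : ∫ y in Ioi 0, boundaryTerm p ε g ε y =
      -∫ z in Ioi ε ×ˢ Ioi 0, (weight z.1 * foldedKernel p ε z.1 z.2 * ((g z.1 - g z.2) * g' z.1) +
        (g z.1 - g z.2) ^ 2 / 2 * formKernel p ε z.1 z.2) ∂(volume.prod volume) := by
    have hI : Integrable (fun z : ℝ × ℝ =>
        weight z.1 * foldedKernel p ε z.1 z.2 * ((g z.1 - g z.2) * g' z.1) +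
        (g z.1 - g z.2) ^ 2 / 2 * formKernel p ε z.1 z.2)
        ((volume.restrict (Ioi ε)).prod (volume.restrict (Ioi 0))) := by
      rw [Measure.prod_restrict]; exact I12
    -- The x-integral is done first, for fixed y; the null set y = ε, where the kernel jumps at the
    -- endpoint, is excluded.
    rw [← Measure.prod_restrict, integral_prod_symm _ hI, ← integral_neg]
    refine integral_congr_ae ?_
    filter_upwards [ae_restrict_mem measurableSet_Ioi, hI.prod_left_ae,
      ae_restrict_of_ae (Measure.ae_ne volume ε)] with y hy hyI hyε
    have h := integral_Ioi_of_hasDerivAt_of_tendsto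
      (continuousAt_boundaryTerm hε hy hyε hgc).continuousWithinAt
      (fun x hx => hasDerivAt_boundaryTerm hp hε hε2 hg hL hx hy) hyI
      (tendsto_boundaryTerm hp hε hε2 hM hy)
    rw [h]; simp
  rw [e1, e2, integral_add I1 I2]
  ring

/-! ### Lower bound for the double integral, uniform in ε. -/

lemma integrableOn_errorKernel (hp : 0 < p) :
    IntegrableOn (fun z : ℝ × ℝ => errorKernel p z.1 z.2) (Ioi 0 ×ˢ Ioi 0)
      (volume.prod volume) := by
  have h1 : IntegrableOn (fun x : ℝ => Real.exp (-(x / 2))) (Ioi 0) := by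
    refine (exp_neg_integrableOn_Ioi 0 (b := 1 / 2) (by norm_num)).congr_fun (fun x _ => ?_)
      measurableSet_Ioi
    simp only; congr 1; ring
  have h2 : IntegrableOn (fun x : ℝ => (1 + x) ^ (-(p + 1))) (Ioi 0) := by
    have := integrableOn_add_rpow_Ioi_of_lt (a := -(p + 1)) (c := 0) (m := 1) (by linarith)
      (by norm_num)
    simpa [add_comm] using this
  rw [IntegrableOn, ← Measure.prod_restrict]
  refine (h1.integrable.mul_prod h2.integrable).add ?_
  have := h2.integrable.mul_prod h1.integrable
  simpa only [mul_comm] using this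

/-- The total mass of `errorKernel` on the quadrant. -/
def errorMass (p : ℝ) : ℝ :=
  ∫ z in Ioi (0 : ℝ) ×ˢ Ioi (0 : ℝ), errorKernel p z.1 z.2 ∂(volume.prod volume)

lemma errorKernel_nonneg {x y : ℝ} (hx : 0 ≤ x) (hy : 0 ≤ y) : 0 ≤ errorKernel p x y := by
  unfold errorKernel; positivity

lemma errorConst_nonneg (hp : 0 < p) : 0 ≤ errorConst p := by unfold errorConst; positivity

lemma errorMass_nonneg : 0 ≤ errorMass p :=
  setIntegral_nonneg (measurableSet_Ioi.prod measurableSet_Ioi) fun _ hz =>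
    errorKernel_nonneg (le_of_lt hz.1) (le_of_lt hz.2)

/-- The strip y ≤ ε contributes a nonnegative amount. On the remaining square, exchanging x and y
averages the form kernel with its transpose, so the pointwise bound applies together with (g(x) -
g(y))² ≤ 4M². -/
lemma integral_form_ge (hp : 0 < p) (hp2 : p < 2) (hε : 0 < ε) (hεp : ε ≤ p / 10)
    (hgm : Measurable g) (hM : ∀ x, |g x| ≤ M) :
    -(M ^ 2 * errorConst p * errorMass p) ≤
      ∫ z in Ioi ε ×ˢ Ioi 0, (g z.1 - g z.2) ^ 2 / 2 * formKernel p ε z.1 z.2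
        ∂(volume.prod volume) := by
  set F : ℝ × ℝ → ℝ := fun z => (g z.1 - g z.2) ^ 2 / 2 * formKernel p ε z.1 z.2 with hF
  have I : IntegrableOn F (Ioi ε ×ˢ Ioi 0) (volume.prod volume) :=
    integrableOn_form hp.le hε (by linarith) hgm hM
  have hsub : Ioi ε ×ˢ Ioi ε ⊆ Ioi ε ×ˢ Ioi (0 : ℝ) :=
    prod_mono_right (Ioi_subset_Ioi hε.le)
  have hsub' : Ioi ε ×ˢ Ioi ε ⊆ Ioi (0 : ℝ) ×ˢ Ioi (0 : ℝ) :=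
    prod_mono (Ioi_subset_Ioi hε.le) (Ioi_subset_Ioi hε.le)
  have hms : MeasurableSet (Ioi ε ×ˢ Ioi ε) := measurableSet_Ioi.prod measurableSet_Ioi
  have I' := I.mono_set hsub
  have hswap : ∫ z in Ioi ε ×ˢ Ioi ε, F z.swap ∂(volume.prod volume) =
      ∫ z in Ioi ε ×ˢ Ioi ε, F z ∂(volume.prod volume) := setIntegral_prod_swap _ _ _
  have Iswap : IntegrableOn (fun z => F z.swap) (Ioi ε ×ˢ Ioi ε) (volume.prod volume) := by
    rw [IntegrableOn, ← Measure.prod_restrict] at I' ⊢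
    exact I'.swap
  have hE := (integrableOn_errorKernel hp).mono_set hsub'
  have step1 : ∫ z in Ioi ε ×ˢ Ioi ε, F z ∂(volume.prod volume) ≤
      ∫ z in Ioi ε ×ˢ Ioi 0, F z ∂(volume.prod volume) := by
    rw [← Ioc_union_Ioi_eq_Ioi hε.le, prod_union]
    rw [← Ioc_union_Ioi_eq_Ioi hε.le, prod_union] at I
    rw [setIntegral_union (by
      rw [Set.disjoint_prod]; right; exact Ioc_disjoint_Ioi_same) hms
      (I.mono_set subset_union_left) (I.mono_set subset_union_right)]
    have : 0 ≤ ∫ z in Ioi ε ×ˢ Ioc 0 ε, F z ∂(volume.prod volume) := by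
      refine setIntegral_nonneg (measurableSet_Ioi.prod measurableSet_Ioc) fun z hz => ?_
      exact mul_nonneg (by positivity)
        (formKernel_nonneg hp.le hε hz.2.1 (hz.2.2.trans (le_of_lt hz.1)))
    linarith
  have step2 : -(2 * M ^ 2 * errorConst p) *
      (∫ z in Ioi ε ×ˢ Ioi ε, errorKernel p z.1 z.2 ∂(volume.prod volume)) ≤
      2 * ∫ z in Ioi ε ×ˢ Ioi ε, F z ∂(volume.prod volume) := by
    have : 2 * ∫ z in Ioi ε ×ˢ Ioi ε, F z ∂(volume.prod volume) =
        ∫ z in Ioi ε ×ˢ Ioi ε, (F z + F z.swap) ∂(volume.prod volume) := by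
      rw [integral_add I' Iswap, hswap]; ring
    rw [this, ← integral_const_mul]
    refine setIntegral_mono_on (hE.const_mul _) (I'.add Iswap) hms fun z hz => ?_
    have h1 := formKernel_add_swap_ge hp hp2 hε hεp (hsub' hz).1 (hsub' hz).2
    have h2 := sq_sub_le hM z.1 z.2
    have h3 : 0 ≤ errorConst p * errorKernel p z.1 z.2 :=
      mul_nonneg (errorConst_nonneg hp)
        (errorKernel_nonneg (le_of_lt (hsub' hz).1) (le_of_lt (hsub' hz).2))
    have h4 : F z + F z.swap = (g z.1 - g z.2) ^ 2 / 2 *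
        (formKernel p ε z.1 z.2 + formKernel p ε z.2 z.1) := by
      simp only [hF, Prod.fst_swap, Prod.snd_swap]; ring
    rw [h4]
    calc -(2 * M ^ 2 * errorConst p) * errorKernel p z.1 z.2
        = -((4 * M ^ 2) / 2 * (errorConst p * errorKernel p z.1 z.2)) := by ring
      _ ≤ -((g z.1 - g z.2) ^ 2 / 2 * (errorConst p * errorKernel p z.1 z.2)) := by
          apply neg_le_neg; gcongr
      _ = (g z.1 - g z.2) ^ 2 / 2 * -(errorConst p * errorKernel p z.1 z.2) := by ring
      _ ≤ _ := by gcongr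
  have step3 : ∫ z in Ioi ε ×ˢ Ioi ε, errorKernel p z.1 z.2 ∂(volume.prod volume) ≤
      errorMass p := by
    refine setIntegral_mono_set (integrableOn_errorKernel hp) ?_ hsub'.eventuallyLE
    filter_upwards [ae_restrict_mem (measurableSet_Ioi.prod measurableSet_Ioi)] with z hz
    exact errorKernel_nonneg (le_of_lt hz.1) (le_of_lt hz.2)
  have h5 : 0 ≤ 2 * M ^ 2 * errorConst p := by
    have := errorConst_nonneg hp
    positivity
  nlinarith

end Identity

/-! ### Passage to the limit ε → 0. -/

/-- The singular integral `∫_{t>0} (g(x+t) - g(x-t)) t^{-p} dt`. -/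
def singularOp (p : ℝ) (g : ℝ → ℝ) (x : ℝ) : ℝ :=
  ∫ t in Ioi 0, (g (x + t) - g (x - t)) * t ^ (-p)

lemma integrableOn_rpow_Ioc {a : ℝ} (ha : -1 < a) : IntegrableOn (fun t : ℝ => t ^ a) (Ioc 0 1) := by
  have := intervalIntegral.intervalIntegrable_rpow' (a := 0) (b := 1) ha
  rwa [intervalIntegrable_iff_integrableOn_Ioc_of_le zero_le_one] at this

lemma integrableOn_min_mul_rpow {p A B : ℝ} (hp : 0 < p) (hp2 : p < 2) (hA : 0 ≤ A) (hB : 0 ≤ B) :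
    IntegrableOn (fun y : ℝ => min (A * y ^ 2) B * y ^ (-(p + 1))) (Ioi 0) := by
  have hm : Measurable (fun y : ℝ => min (A * y ^ 2) B * y ^ (-(p + 1))) := by fun_prop
  rw [← Ioc_union_Ioi_eq_Ioi (zero_le_one' ℝ), integrableOn_union]
  constructor
  · refine Integrable.mono' ((integrableOn_rpow_Ioc (a := 1 - p) (by linarith)).const_mul A)
      hm.aestronglyMeasurable ?_
    filter_upwards [ae_restrict_mem measurableSet_Ioc] with y hy
    have hy0 : 0 < y := hy.1
    have e : y ^ (1 - p) = y ^ 2 * y ^ (-(p + 1)) := by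
      rw [← Real.rpow_natCast, ← Real.rpow_add hy0]; congr 1; push_cast; ring
    rw [Real.norm_of_nonneg (by positivity), e, ← mul_assoc]
    gcongr
    exact min_le_left _ _
  · refine Integrable.mono' ((integrableOn_Ioi_rpow_of_lt (a := -(p + 1)) (by linarith)
      one_pos).const_mul B) hm.aestronglyMeasurable ?_
    filter_upwards [ae_restrict_mem measurableSet_Ioi] with y hy
    have hy0 : 0 < y := one_pos.trans hy
    rw [Real.norm_of_nonneg (by positivity)]
    gcongr
    exact min_le_right _ _

section Limit

variable {p ε M L : ℝ} {g g' : ℝ → ℝ}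

/-- The minimum is what makes y^{-p-1} integrable at both ends for 0 < p < 2: Lipschitz decay at 0,
boundedness at infinity. -/
lemma sq_sub_le_min (hg : ∀ x, HasDerivAt g (g' x) x) (hM : ∀ x, |g x| ≤ M)
    (hL : ∀ x, |g' x| ≤ L) {x y : ℝ} (hx : 0 ≤ x) (hxy : x ≤ y) :
    (g x - g y) ^ 2 ≤ min (L ^ 2 * y ^ 2) (4 * M ^ 2) := by
  refine le_min ?_ (sq_sub_le hM x y)
  have h := abs_sub_le_of_deriv hg hL x y
  have hL0 : 0 ≤ L := (abs_nonneg _).trans (hL 0)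
  rw [← sq_abs, ← mul_pow]
  gcongr
  refine h.trans ?_
  gcongr
  rw [abs_sub_comm, abs_of_nonneg (by linarith)]
  linarith

lemma integrableOn_sq_mul_rpow (hp : 0 < p) (hp2 : p < 2) (hg : ∀ x, HasDerivAt g (g' x) x)
    (hM : ∀ x, |g x| ≤ M) (hL : ∀ x, |g' x| ≤ L) :
    IntegrableOn (fun y : ℝ => (g 0 - g y) ^ 2 * y ^ (-(p + 1))) (Ioi 0) := by
  have hgc : Continuous g := continuous_iff_continuousAt.2 fun x => (hg x).continuousAt
  have hgm := hgc.measurable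
  refine Integrable.mono' (integrableOn_min_mul_rpow hp hp2 (sq_nonneg L)
    (show 0 ≤ 4 * M ^ 2 by positivity)) (Measurable.aestronglyMeasurable (by fun_prop)) ?_
  filter_upwards [ae_restrict_mem measurableSet_Ioi] with y hy
  have hy0 : 0 < y := hy
  rw [Real.norm_of_nonneg (by positivity)]
  gcongr
  exact sq_sub_le_min hg hM hL le_rfl hy0.le

/-- A decreasing slope is smallest at the right end of an interval, here of length 2ε. The factor ε
cancels the 1/ε in `weight ε`, which is why the boundary term has a positive limit. -/
lemma kernel_sub_ge {y : ℝ} (hp : 0 ≤ p) (hε : 0 < ε) (hy : ε ≤ y) :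
    2 * ε * kernelSlope p ε (ε + y) ≤ kernel p ε (y - ε) - kernel p ε (ε + y) := by
  have hanti : MonotoneOn (fun t => -kernel p ε t - kernelSlope p ε (ε + y) * t)
      (Icc (y - ε) (ε + y)) := by
    have hd : ∀ t ∈ Icc (y - ε) (ε + y), HasDerivAt
        (fun t => -kernel p ε t - kernelSlope p ε (ε + y) * t)
        (kernelSlope p ε t - kernelSlope p ε (ε + y)) t := by
      intro t ht
      refine ((hasDerivAt_kernel (p := p) (by linarith [ht.1])).neg.sub
        ((hasDerivAt_id t).const_mul _)).congr_deriv (by ring)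
    refine monotoneOn_of_deriv_nonneg (convex_Icc _ _)
      (fun t ht => (hd t ht).continuousAt.continuousWithinAt)
      (fun t ht => (hd t (interior_subset ht)).differentiableAt.differentiableWithinAt)
      (fun t ht => ?_)
    have ht' := interior_subset ht
    rw [(hd t ht').deriv, sub_nonneg]
    exact kernelSlope_antitone hp hε (by linarith [ht'.1]) ht'.2
  have := hanti ⟨le_rfl, by linarith⟩ ⟨by linarith, le_rfl⟩ (show y - ε ≤ ε + y by linarith)
  simp only at this
  nlinarith

lemma integrableOn_boundaryTerm (hp : 0 ≤ p) (hε : 0 < ε) (hε2 : ε ≤ 1 / 2)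
    (hgm : Measurable g) (hM : ∀ x, |g x| ≤ M) :
    IntegrableOn (fun y => boundaryTerm p ε g ε y) (Ioi 0) := by
  obtain ⟨C, hC0, hC⟩ := exists_abs_kernels_le hp hε hε2
  refine Integrable.mono' ((exp_neg_integrableOn_Ioi 0 hε).const_mul
    (C * Real.exp (-(1 / 2) * ε) * (4 * M ^ 2 / 2))) ?_ ?_
  · have h1 : Measurable (fun y => foldedKernel p ε ε y) :=
      (measurable_foldedKernel p ε).comp (measurable_const.prodMk measurable_id)
    unfold boundaryTerm
    exact Measurable.aestronglyMeasurable (by fun_prop)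
  · filter_upwards [ae_restrict_mem measurableSet_Ioi] with y hy
    have h1 := (hC ε y le_rfl hy).1
    have h2 := sq_sub_le hM ε y
    rw [boundaryTerm, Real.norm_eq_abs, abs_mul,
      abs_of_nonneg (show 0 ≤ (g ε - g y) ^ 2 / 2 by positivity)]
    calc _ ≤ C * (Real.exp (-(1 / 2) * ε) * Real.exp (-ε * y)) * (4 * M ^ 2 / 2) := by gcongr
      _ = _ := by ring

/-- The main part of the boundary term. -/
def boundaryMain (p : ℝ) (g : ℝ → ℝ) (ε y : ℝ) : ℝ :=
  (Ioi ε).indicator (fun y => Real.exp (-ε) * kernelSlope p ε (ε + y) * (g ε - g y) ^ 2) y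

lemma boundaryMain_le_boundaryTerm (hp : 0 ≤ p) (hε : 0 < ε) {y : ℝ} (hy : ε < y) :
    boundaryMain p g ε y ≤ boundaryTerm p ε g ε y := by
  have h := kernel_sub_ge hp hε hy.le
  unfold boundaryMain boundaryTerm foldedKernel weight
  rw [indicator_of_mem (mem_Ioi.2 hy), if_pos hy]
  calc Real.exp (-ε) * kernelSlope p ε (ε + y) * (g ε - g y) ^ 2
      = Real.exp (-ε) / ε * (2 * ε * kernelSlope p ε (ε + y)) * ((g ε - g y) ^ 2 / 2) := by
        field_simp
    _ ≤ _ := by gcongr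

/-- For y ≤ ε the boundary term is negative, of size at most ε⁻¹ · ε^{-p} · ε². Integrated over an
interval of length ε it is O(ε^{2-p}), which vanishes in the limit since p < 2. -/
lemma neg_le_boundaryTerm (hp : 0 ≤ p) (hε : 0 < ε) (hg : ∀ x, HasDerivAt g (g' x) x)
    (hL : ∀ x, |g' x| ≤ L) {y : ℝ} (hy : 0 < y) (hyε : y ≤ ε) :
    -(L ^ 2 * ε ^ (1 - p)) ≤ boundaryTerm p ε g ε y := by
  have hk : ∀ t, 0 ≤ t → kernel p ε t ≤ ε ^ (-p) := by
    intro t ht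
    refine (kernel_le_exp hp hε ht).trans (mul_le_of_le_one_right (by positivity) ?_)
    exact Real.exp_le_one_iff.2 (by nlinarith)
  have h1 := hk (ε - y) (by linarith)
  have h2 := hk (ε + y) (by linarith)
  have h1' := kernel_nonneg (p := p) hε.le (sub_nonneg.2 hyε)
  have h2' := kernel_nonneg (p := p) hε.le (add_pos hε hy).le
  have hw : weight ε ≤ ε⁻¹ := by
    refine (weight_le hε le_rfl).trans (mul_le_of_le_one_right (by positivity) ?_)
    exact Real.exp_le_one_iff.2 (by linarith)
  have hw0 := weight_pos hε
  have hs : (g ε - g y) ^ 2 ≤ L ^ 2 * ε ^ 2 := by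
    have h := abs_sub_le_of_deriv hg hL ε y
    have hL0 : 0 ≤ L := (abs_nonneg _).trans (hL 0)
    rw [← sq_abs, ← mul_pow]
    gcongr
    refine h.trans ?_
    gcongr
    rw [abs_of_nonneg (by linarith)]
    linarith
  have e : ε ^ (1 - p) = ε⁻¹ * (2 * ε ^ (-p)) * (ε ^ 2 / 2) := by
    rw [sub_eq_add_neg, Real.rpow_add hε, Real.rpow_one]; field_simp
  unfold boundaryTerm foldedKernel
  rw [if_neg (not_lt.2 hyε)]
  have : weight ε * (kernel p ε (ε - y) + kernel p ε (ε + y)) * ((g ε - g y) ^ 2 / 2) ≤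
      L ^ 2 * ε ^ (1 - p) := by
    calc _ ≤ ε⁻¹ * (2 * ε ^ (-p)) * (L ^ 2 * ε ^ 2 / 2) := by gcongr; linarith
      _ = _ := by rw [e]; ring
  linarith

lemma boundaryMain_bound (hp : 0 ≤ p) (hε : 0 < ε) (hg : ∀ x, HasDerivAt g (g' x) x)
    (hM : ∀ x, |g x| ≤ M) (hL : ∀ x, |g' x| ≤ L) {y : ℝ} (hy : 0 < y) :
    ‖boundaryMain p g ε y‖ ≤ (p + 1) * (min (L ^ 2 * y ^ 2) (4 * M ^ 2) * y ^ (-(p + 1))) := by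
  unfold boundaryMain
  by_cases h : ε < y
  · rw [indicator_of_mem (mem_Ioi.2 h)]
    have h0 := kernelSlope_nonneg hp hε.le (add_pos hε hy).le
    have h1 : kernelSlope p ε (ε + y) ≤ (p + 1) * y ^ (-(p + 1)) :=
      (kernelSlope_antitone hp hε hy.le (by linarith)).trans (kernelSlope_le hp hε hy)
    have h2 := sq_sub_le_min hg hM hL hε.le h.le
    have h3 : Real.exp (-ε) ≤ 1 := Real.exp_le_one_iff.2 (by linarith)
    rw [Real.norm_of_nonneg (by positivity)]
    calc _ ≤ 1 * ((p + 1) * y ^ (-(p + 1))) * min (L ^ 2 * y ^ 2) (4 * M ^ 2) := by gcongr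
      _ = _ := by ring
  · rw [indicator_of_notMem (by simpa using h)]
    simp only [norm_zero]
    positivity

lemma aestronglyMeasurable_boundaryMain (hgm : Measurable g) (μ : Measure ℝ) :
    AEStronglyMeasurable (boundaryMain p g ε) μ := by
  unfold boundaryMain kernelSlope
  refine (Measurable.indicator ?_ measurableSet_Ioi).aestronglyMeasurable
  fun_prop

lemma integral_boundaryTerm_ge (hp : 0 < p) (hp2 : p < 2) (hε : 0 < ε) (hε2 : ε ≤ 1 / 2)
    (hg : ∀ x, HasDerivAt g (g' x) x) (hM : ∀ x, |g x| ≤ M) (hL : ∀ x, |g' x| ≤ L) :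
    (∫ y in Ioi 0, boundaryMain p g ε y) - L ^ 2 * ε ^ (2 - p) ≤
      ∫ y in Ioi 0, boundaryTerm p ε g ε y := by
  have hgc : Continuous g := continuous_iff_continuousAt.2 fun x => (hg x).continuousAt
  have hI : IntegrableOn (boundaryMain p g ε) (Ioi 0) := by
    refine Integrable.mono' ((integrableOn_min_mul_rpow hp hp2 (sq_nonneg L)
      (show 0 ≤ 4 * M ^ 2 by positivity)).const_mul (p + 1))
      (aestronglyMeasurable_boundaryMain hgc.measurable _) ?_
    filter_upwards [ae_restrict_mem measurableSet_Ioi] with y hy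
    exact boundaryMain_bound hp.le hε hg hM hL hy
  have hB := integrableOn_boundaryTerm hp.le hε hε2 hgc.measurable hM
  have hs1 : Ioc 0 ε ⊆ Ioi 0 := Ioc_subset_Ioi_self
  have hs2 : Ioi ε ⊆ Ioi 0 := Ioi_subset_Ioi hε.le
  rw [← Ioc_union_Ioi_eq_Ioi hε.le, setIntegral_union Ioc_disjoint_Ioi_same measurableSet_Ioi
    (hI.mono_set hs1) (hI.mono_set hs2), setIntegral_union Ioc_disjoint_Ioi_same measurableSet_Ioi
    (hB.mono_set hs1) (hB.mono_set hs2)]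
  have h1 : ∫ y in Ioc 0 ε, boundaryMain p g ε y = 0 := by
    refine setIntegral_eq_zero_of_forall_eq_zero fun y hy => ?_
    exact indicator_of_notMem (by simpa using hy.2) _
  have h2 : ∫ y in Ioi ε, boundaryMain p g ε y ≤ ∫ y in Ioi ε, boundaryTerm p ε g ε y :=
    setIntegral_mono_on (hI.mono_set hs2) (hB.mono_set hs2) measurableSet_Ioi
      fun y hy => boundaryMain_le_boundaryTerm hp.le hε hy
  have h3 : -(L ^ 2 * ε ^ (2 - p)) ≤ ∫ y in Ioc 0 ε, boundaryTerm p ε g ε y := by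
    have h := setIntegral_mono_on (μ := volume) (f := fun _ => -(L ^ 2 * ε ^ (1 - p)))
      (integrable_const _) (hB.mono_set hs1) measurableSet_Ioc
      fun y hy => neg_le_boundaryTerm hp.le hε hg hL hy.1 hy.2
    refine le_trans (le_of_eq ?_) h
    rw [setIntegral_const, Real.volume_real_Ioc_of_le hε.le, smul_eq_mul,
      show 2 - p = 1 + (1 - p) by ring, Real.rpow_add hε 1, Real.rpow_one]
    ring
  linarith

lemma tendsto_kernelSlope {y : ℝ} (hy : 0 < y) :
    Tendsto (fun ε => kernelSlope p ε (ε + y)) (𝓝[>] 0) (𝓝 (p * y ^ (-(p + 1)))) := by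
  have h : ContinuousAt (fun ε => kernelSlope p ε (ε + y)) 0 := by
    unfold kernelSlope
    have h1 : ContinuousAt (fun ε : ℝ => (ε + y + ε) ^ (-p - 1)) 0 :=
      ContinuousAt.rpow_const (by fun_prop) (Or.inl (by simpa using hy.ne'))
    have h2 : ContinuousAt (fun ε : ℝ => (ε + y + ε) ^ (-p)) 0 :=
      ContinuousAt.rpow_const (by fun_prop) (Or.inl (by simpa using hy.ne'))
    fun_prop
  have h' := h.tendsto.mono_left (nhdsWithin_le_nhds (s := Ioi 0))
  convert h' using 2
  rw [neg_add']
  simp [kernelSlope]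

lemma tendsto_integral_boundaryMain (hp : 0 < p) (hp2 : p < 2)
    (hg : ∀ x, HasDerivAt g (g' x) x) (hM : ∀ x, |g x| ≤ M) (hL : ∀ x, |g' x| ≤ L) :
    Tendsto (fun ε => ∫ y in Ioi 0, boundaryMain p g ε y) (𝓝[>] 0)
      (𝓝 (∫ y in Ioi 0, p * ((g 0 - g y) ^ 2 * y ^ (-(p + 1))))) := by
  have hgc : Continuous g := continuous_iff_continuousAt.2 fun x => (hg x).continuousAt
  refine tendsto_integral_filter_of_dominated_convergence
    (fun y => (p + 1) * (min (L ^ 2 * y ^ 2) (4 * M ^ 2) * y ^ (-(p + 1)))) ?_ ?_ ?_ ?_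
  · exact Eventually.of_forall fun ε => aestronglyMeasurable_boundaryMain hgc.measurable _
  · filter_upwards [self_mem_nhdsWithin] with ε hε
    filter_upwards [ae_restrict_mem measurableSet_Ioi] with y hy
    exact boundaryMain_bound hp.le hε hg hM hL hy
  · exact (integrableOn_min_mul_rpow hp hp2 (sq_nonneg L)
      (show 0 ≤ 4 * M ^ 2 by positivity)).const_mul (p + 1)
  · filter_upwards [ae_restrict_mem measurableSet_Ioi] with y hy
    have h1 : Tendsto (fun ε : ℝ => Real.exp (-ε)) (𝓝[>] 0) (𝓝 (Real.exp (-0))) :=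
      (ContinuousAt.tendsto (by fun_prop)).mono_left nhdsWithin_le_nhds
    have h2 : Tendsto (fun ε : ℝ => (g ε - g y) ^ 2) (𝓝[>] 0) (𝓝 ((g 0 - g y) ^ 2)) :=
      (ContinuousAt.tendsto (f := fun ε => (g ε - g y) ^ 2) (by fun_prop)).mono_left
        nhdsWithin_le_nhds
    have h3 := (h1.mul (tendsto_kernelSlope (p := p) hy)).mul h2
    rw [neg_zero, Real.exp_zero, one_mul] at h3
    rw [show p * ((g 0 - g y) ^ 2 * y ^ (-(p + 1))) = p * y ^ (-(p + 1)) * (g 0 - g y) ^ 2 by ring]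
    refine h3.congr' ?_
    have : ∀ᶠ ε in 𝓝[>] (0 : ℝ), ε < y :=
      nhdsWithin_le_nhds (eventually_lt_nhds hy)
    filter_upwards [this] with ε hε
    rw [boundaryMain, indicator_of_mem (mem_Ioi.2 hε)]

lemma integrable_indicator_rpow (hp2 : p < 2) (A : ℝ) :
    Integrable ((Ioc 0 1).indicator (fun t : ℝ => A * t ^ (1 - p))) := by
  refine IntegrableOn.integrable_indicator ?_ measurableSet_Ioc
  exact (integrableOn_rpow_Ioc (by linarith)).const_mul A

/-- A majorant of the integrand of `singularOp`, whose integral is bounded in `x`. -/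
def singularBound (p L : ℝ) (g : ℝ → ℝ) (x t : ℝ) : ℝ :=
  (Ioc 0 1).indicator (fun t => 2 * L * t ^ (1 - p)) t + (|g (x + t)| + |g (x - t)|)

lemma integrable_singularBound (hp2 : p < 2) (hgi : Integrable g) (x : ℝ) :
    Integrable (singularBound p L g x) := by
  exact (integrable_indicator_rpow hp2 _).add
    ((hgi.comp_add_left x).abs.add (hgi.comp_sub_left x).abs)

/-- For t ≤ 1 the Lipschitz bound gains a factor t; for t > 1 the power is at most 1 and
integrability of g suffices. -/
lemma abs_integrand_le_singularBound (hp : 0 ≤ p) (hg : ∀ x, HasDerivAt g (g' x) x)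
    (hL : ∀ x, |g' x| ≤ L) (x : ℝ) {t : ℝ} (ht : 0 < t) :
    |g (x + t) - g (x - t)| * t ^ (-p) ≤ singularBound p L g x t := by
  unfold singularBound
  have htp : 0 ≤ t ^ (-p) := by positivity
  by_cases h : t ≤ 1
  · rw [indicator_of_mem (show t ∈ Ioc 0 1 from ⟨ht, h⟩)]
    have h1 := abs_sub_le_of_deriv hg hL (x + t) (x - t)
    rw [show x + t - (x - t) = 2 * t by ring, abs_of_pos (show 0 < 2 * t by linarith)] at h1
    have e : t ^ (1 - p) = t * t ^ (-p) := by
      rw [sub_eq_add_neg, Real.rpow_add ht, Real.rpow_one]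
    rw [e]
    have : |g (x + t) - g (x - t)| * t ^ (-p) ≤ L * (2 * t) * t ^ (-p) := by gcongr
    nlinarith [abs_nonneg (g (x + t)), abs_nonneg (g (x - t))]
  · rw [indicator_of_notMem (by simp [h]), zero_add]
    have h1 : t ^ (-p) ≤ 1 := Real.rpow_le_one_of_one_le_of_nonpos (by linarith) (by linarith)
    have h2 := abs_sub (g (x + t)) (g (x - t))
    exact (mul_le_of_le_one_right (abs_nonneg _) h1).trans h2

lemma kernel_le_rpow (hp : 0 ≤ p) (hε : 0 < ε) {t : ℝ} (ht : 0 < t) :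
    kernel p ε t ≤ t ^ (-p) := by
  unfold kernel
  refine (mul_le_of_le_one_right (by positivity) ?_).trans
    (Real.rpow_le_rpow_of_nonpos ht (by linarith) (by linarith))
  exact Real.exp_le_one_iff.2 (by nlinarith)

/-- A bound for `singularOp` uniform in `x`. -/
def singularMass (p L : ℝ) (g : ℝ → ℝ) : ℝ :=
  (∫ t, (Ioc 0 1).indicator (fun t : ℝ => 2 * L * t ^ (1 - p)) t) + 2 * ∫ t, |g t|

lemma setIntegral_singularBound_le (hp2 : p < 2) (hL0 : 0 ≤ L) (hgi : Integrable g) (x : ℝ) :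
    ∫ t in Ioi 0, singularBound p L g x t ≤ singularMass p L g := by
  have h0 : ∀ t, 0 ≤ singularBound p L g x t := fun t => by
    unfold singularBound
    refine add_nonneg (indicator_nonneg (fun t ht => ?_) t) (by positivity)
    have : 0 < t := ht.1
    positivity
  refine (setIntegral_le_integral (integrable_singularBound hp2 hgi x)
    (Eventually.of_forall h0)).trans (le_of_eq ?_)
  unfold singularBound singularMass
  rw [integral_add, integral_add]
  · rw [integral_add_left_eq_self (fun t => |g t|) x, integral_sub_left_eq_self (fun t => |g t|)]
    ring
  · exact (hgi.comp_add_left x).abs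
  · exact (hgi.comp_sub_left x).abs
  · exact integrable_indicator_rpow hp2 _
  · exact (hgi.comp_add_left x).abs.add (hgi.comp_sub_left x).abs

lemma abs_regOp_le (hp : 0 ≤ p) (hp2 : p < 2) (hε : 0 < ε) (hg : ∀ x, HasDerivAt g (g' x) x)
    (hL : ∀ x, |g' x| ≤ L) (hgi : Integrable g) (x : ℝ) :
    |regOp p ε g x| ≤ singularMass p L g := by
  refine le_trans ?_ (setIntegral_singularBound_le hp2 ((abs_nonneg _).trans (hL 0)) hgi x)
  rw [← Real.norm_eq_abs, regOp]
  refine norm_integral_le_of_norm_le (integrable_singularBound hp2 hgi x).integrableOn ?_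
  filter_upwards [ae_restrict_mem measurableSet_Ioi] with t ht
  rw [norm_mul, Real.norm_eq_abs, Real.norm_of_nonneg (kernel_nonneg hε.le (le_of_lt ht))]
  refine le_trans ?_ (abs_integrand_le_singularBound hp hg hL x ht)
  gcongr
  exact kernel_le_rpow hp hε ht

lemma tendsto_regOp (hp : 0 ≤ p) (hp2 : p < 2) (hg : ∀ x, HasDerivAt g (g' x) x)
    (hL : ∀ x, |g' x| ≤ L) (hgi : Integrable g) (x : ℝ) :
    Tendsto (fun ε => regOp p ε g x) (𝓝[>] 0) (𝓝 (singularOp p g x)) := by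
  have hgc : Continuous g := continuous_iff_continuousAt.2 fun x => (hg x).continuousAt
  have hgm := hgc.measurable
  refine tendsto_integral_filter_of_dominated_convergence (singularBound p L g x) ?_ ?_
    (integrable_singularBound hp2 hgi x).integrableOn ?_
  · refine Eventually.of_forall fun ε => Measurable.aestronglyMeasurable ?_
    have := measurable_kernel p ε
    fun_prop
  · filter_upwards [self_mem_nhdsWithin] with ε hε
    filter_upwards [ae_restrict_mem measurableSet_Ioi] with t ht
    rw [norm_mul, Real.norm_eq_abs,
      Real.norm_of_nonneg (kernel_nonneg (le_of_lt hε) (le_of_lt ht))]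
    refine le_trans ?_ (abs_integrand_le_singularBound hp hg hL x ht)
    gcongr
    exact kernel_le_rpow hp hε ht
  · filter_upwards [ae_restrict_mem measurableSet_Ioi] with t ht
    refine Tendsto.const_mul _ ?_
    have h : ContinuousAt (fun ε => kernel p ε t) 0 := by
      unfold kernel
      have h2 : ContinuousAt (fun ε : ℝ => (t + ε) ^ (-p)) 0 :=
        ContinuousAt.rpow_const (by fun_prop) (Or.inl (by simpa using (ne_of_gt ht)))
      fun_prop
    have h' := h.tendsto.mono_left (nhdsWithin_le_nhds (s := Ioi 0))
    simpa [kernel] using h'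

lemma measurable_regOp (hgm : Measurable g) : Measurable (regOp p ε g) := by
  have := measurable_kernel p ε
  have h : Measurable (fun z : ℝ × ℝ => (g (z.1 + z.2) - g (z.1 - z.2)) * kernel p ε z.2) := by
    fun_prop
  exact (h.stronglyMeasurable.integral_prod_right (ν := volume.restrict (Ioi 0))).measurable

/-- Linear vanishing of g' at the origin, a consequence of evenness, cancels the singularity of the
weight. -/
lemma weight_mul_abs_le {L₂ : ℝ} (hg'0 : ∀ x, |g' x| ≤ L₂ * |x|) {x : ℝ} (hx : 0 < x) :
    weight x * |g' x| ≤ L₂ * Real.exp (-x) := by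
  have h := hg'0 x
  rw [abs_of_pos hx] at h
  unfold weight
  calc Real.exp (-x) / x * |g' x| ≤ Real.exp (-x) / x * (L₂ * x) := by gcongr
    _ = _ := by field_simp

lemma integrableOn_exp_neg : IntegrableOn (fun x : ℝ => Real.exp (-x)) (Ioi 0) := by
  simpa using exp_neg_integrableOn_Ioi 0 one_pos

lemma tendsto_integral_regOp {L₂ : ℝ} (hp : 0 ≤ p) (hp2 : p < 2)
    (hg : ∀ x, HasDerivAt g (g' x) x) (hg'm : Measurable g')
    (hL : ∀ x, |g' x| ≤ L) (hgi : Integrable g) (hg'0 : ∀ x, |g' x| ≤ L₂ * |x|) :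
    Tendsto (fun ε => ∫ x in Ioi ε, weight x * g' x * regOp p ε g x) (𝓝[>] 0)
      (𝓝 (∫ x in Ioi 0, weight x * g' x * singularOp p g x)) := by
  have hgc : Continuous g := continuous_iff_continuousAt.2 fun x => (hg x).continuousAt
  have key : Tendsto (fun ε => ∫ x in Ioi 0, (Ioi ε).indicator
      (fun x => weight x * g' x * regOp p ε g x) x) (𝓝[>] 0)
      (𝓝 (∫ x in Ioi 0, weight x * g' x * singularOp p g x)) := by
    refine tendsto_integral_filter_of_dominated_convergence
      (fun x => L₂ * Real.exp (-x) * singularMass p L g) ?_ ?_ ?_ ?_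
    · refine Eventually.of_forall fun ε => Measurable.aestronglyMeasurable ?_
      refine Measurable.indicator ?_ measurableSet_Ioi
      have := measurable_regOp (p := p) (ε := ε) hgc.measurable
      have := measurable_weight
      fun_prop
    · filter_upwards [self_mem_nhdsWithin] with ε hε
      filter_upwards [ae_restrict_mem measurableSet_Ioi] with x hx
      refine (norm_indicator_le_norm_self _ _).trans ?_
      have hw := weight_mul_abs_le hg'0 hx
      have hr := abs_regOp_le hp hp2 hε hg hL hgi x
      have h0 : 0 ≤ weight x * |g' x| := mul_nonneg (weight_pos hx).le (abs_nonneg _)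
      rw [Real.norm_eq_abs, abs_mul, abs_mul, abs_of_pos (weight_pos hx)]
      exact mul_le_mul hw hr (abs_nonneg _) (h0.trans hw)
    · exact (integrableOn_exp_neg.const_mul _).mul_const _
    · filter_upwards [ae_restrict_mem measurableSet_Ioi] with x hx
      refine ((tendsto_regOp hp hp2 hg hL hgi x).const_mul (weight x * g' x)).congr' ?_
      have : ∀ᶠ ε in 𝓝[>] (0 : ℝ), ε < x := nhdsWithin_le_nhds (eventually_lt_nhds hx)
      filter_upwards [this] with ε hε
      rw [indicator_of_mem (mem_Ioi.2 hε)]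
  refine key.congr' ?_
  filter_upwards [self_mem_nhdsWithin] with ε hε
  rw [setIntegral_indicator measurableSet_Ioi,
    inter_eq_self_of_subset_right (Ioi_subset_Ioi (le_of_lt hε))]

/-- The coercivity estimate for the singular integral operator with kernel `t^{-p}`. -/
theorem integral_weight_mul_singularOp_ge {L₂ : ℝ} (hp : 0 < p) (hp2 : p < 2)
    (hg : ∀ x, HasDerivAt g (g' x) x) (hg'm : Measurable g') (hM : ∀ x, |g x| ≤ M)
    (hL : ∀ x, |g' x| ≤ L) (hev : ∀ x, g (-x) = g x) (hgi : Integrable g)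
    (hg'0 : ∀ x, |g' x| ≤ L₂ * |x|) :
    p * (∫ y in Ioi 0, (g 0 - g y) ^ 2 * y ^ (-(p + 1))) - M ^ 2 * errorConst p * errorMass p ≤
      ∫ x in Ioi 0, weight x * g' x * singularOp p g x := by
  have hgc : Continuous g := continuous_iff_continuousAt.2 fun x => (hg x).continuousAt
  have h1 := tendsto_integral_regOp hp.le hp2 hg hg'm hL hgi hg'0
  have h2 := tendsto_integral_boundaryMain hp hp2 hg hM hL
  have h3 : Tendsto (fun ε : ℝ => L ^ 2 * ε ^ (2 - p)) (𝓝[>] 0) (𝓝 0) := by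
    have h : ContinuousAt (fun ε : ℝ => L ^ 2 * ε ^ (2 - p)) 0 :=
      (Real.continuousAt_rpow_const _ _ (Or.inr (by linarith))).const_mul _
    have h' := h.tendsto.mono_left (nhdsWithin_le_nhds (s := Ioi 0))
    rwa [Real.zero_rpow (by linarith), mul_zero] at h'
  have h4 := (h2.sub h3).sub_const (M ^ 2 * errorConst p * errorMass p)
  rw [sub_zero, integral_const_mul] at h4
  refine le_of_tendsto_of_tendsto h4 h1 ?_
  have hsm : ∀ᶠ ε in 𝓝[>] (0 : ℝ), ε < p / 10 :=
    nhdsWithin_le_nhds (eventually_lt_nhds (by positivity))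
  filter_upwards [self_mem_nhdsWithin, hsm] with ε hε hεp
  have hε2 : ε ≤ 1 / 2 := by linarith
  rw [integral_weight_mul_regOp hp.le hε hε2 hg hg'm hM hL hev]
  have a1 := integral_boundaryTerm_ge hp hp2 hε hε2 hg hM hL
  have a2 := integral_form_ge hp hp2 hε hεp.le hgc.measurable hM
  linarith

end Limit

/-! ### The sine integral and its Laplace representation. -/

/-- The incomplete sine integral `∫_0^U sin u u^{-p} du`. -/
def sineIntegral (p U : ℝ) : ℝ := ∫ u in (0 : ℝ)..U, Real.sin u * u ^ (-p)

/-- The limit of `sineIntegral p U` as `U → ∞`. -/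
def sineConst (p : ℝ) : ℝ :=
  (Real.Gamma p)⁻¹ * ∫ s in Ioi (0 : ℝ), s ^ (p - 1) * (1 + s ^ 2)⁻¹

section SineIntegral

variable {p : ℝ}

lemma integrableOn_rpow_mul_inv (hp : 0 < p) (hp2 : p < 2) :
    IntegrableOn (fun s : ℝ => s ^ (p - 1) * (1 + s ^ 2)⁻¹) (Ioi 0) := by
  have hm : Measurable (fun s : ℝ => s ^ (p - 1) * (1 + s ^ 2)⁻¹) := by fun_prop
  rw [← Ioc_union_Ioi_eq_Ioi (zero_le_one' ℝ), integrableOn_union]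
  constructor
  · refine Integrable.mono' (integrableOn_rpow_Ioc (a := p - 1) (by linarith))
      hm.aestronglyMeasurable ?_
    filter_upwards [ae_restrict_mem measurableSet_Ioc] with s hs
    have hs0 : 0 < s := hs.1
    rw [Real.norm_of_nonneg (by positivity)]
    refine mul_le_of_le_one_right (by positivity) (inv_le_one_of_one_le₀ ?_)
    nlinarith
  · refine Integrable.mono' (integrableOn_Ioi_rpow_of_lt (a := p - 3) (by linarith) one_pos)
      hm.aestronglyMeasurable ?_
    filter_upwards [ae_restrict_mem measurableSet_Ioi] with s hs
    have hs0 : 0 < s := one_pos.trans hs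
    have e : s ^ (p - 3) = s ^ (p - 1) * (s ^ 2)⁻¹ := by
      rw [← Real.rpow_natCast, ← Real.rpow_neg hs0.le, ← Real.rpow_add hs0]
      congr 1; push_cast; ring
    rw [Real.norm_of_nonneg (by positivity), e]
    gcongr
    linarith

lemma sineConst_pos (hp : 0 < p) (hp2 : p < 2) : 0 < sineConst p := by
  unfold sineConst
  refine mul_pos (inv_pos.2 (Real.Gamma_pos_of_pos hp)) ?_
  refine (setIntegral_pos_iff_support_of_nonneg_ae ?_ (integrableOn_rpow_mul_inv hp hp2)).2 ?_
  · filter_upwards [ae_restrict_mem measurableSet_Ioi] with s hs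
    have hs0 : 0 < s := hs
    simp only [Pi.zero_apply]
    positivity
  · have : Function.support (fun s : ℝ => s ^ (p - 1) * (1 + s ^ 2)⁻¹) ∩ Ioi 0 = Ioi 0 := by
      refine inter_eq_self_of_subset_right fun s hs => ?_
      have hs0 : 0 < s := hs
      have : 0 < s ^ (p - 1) * (1 + s ^ 2)⁻¹ := by positivity
      exact this.ne'
    rw [this]; simp

lemma sineConst_one : sineConst 1 = Real.pi / 2 := by
  simp [sineConst, integral_Ioi_inv_one_add_sq]

lemma integral_sin_mul_exp (s U : ℝ) :
    ∫ u in (0 : ℝ)..U, Real.sin u * Real.exp (-(u * s)) =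
      (1 - Real.exp (-(U * s)) * (Real.cos U + s * Real.sin U)) * (1 + s ^ 2)⁻¹ := by
  have hpos : (1 : ℝ) + s ^ 2 ≠ 0 := by positivity
  have hd : ∀ u ∈ uIcc 0 U, HasDerivAt
      (fun u => -(Real.exp (-(u * s)) * (Real.cos u + s * Real.sin u)) * (1 + s ^ 2)⁻¹)
      (Real.sin u * Real.exp (-(u * s))) u := by
    intro u _
    have h1 : HasDerivAt (fun u : ℝ => Real.exp (-(u * s))) (Real.exp (-(u * s)) * -s) u := by
      simpa using ((hasDerivAt_id u).mul_const s).neg.exp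
    have h2 := (Real.hasDerivAt_cos u).add ((Real.hasDerivAt_sin u).const_mul s)
    refine ((h1.mul h2).neg.mul_const _).congr_deriv ?_
    simp only [Pi.add_apply]
    field_simp
    ring
  rw [intervalIntegral.integral_eq_sub_of_hasDerivAt hd
    (Continuous.intervalIntegrable (by fun_prop) _ _)]
  simp
  ring

lemma integrableOn_sin_mul_rpow (hp2 : p < 2) (U : ℝ) :
    IntegrableOn (fun u : ℝ => Real.sin u * u ^ (-p)) (Ioc 0 U) := by
  have h : IntegrableOn (fun u : ℝ => u ^ (1 - p)) (Ioc 0 U) := by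
    rcases le_or_gt 0 U with hU | hU
    · have := intervalIntegral.intervalIntegrable_rpow' (a := 0) (b := U) (r := 1 - p)
        (by linarith)
      rwa [intervalIntegrable_iff_integrableOn_Ioc_of_le hU] at this
    · rw [Ioc_eq_empty (by linarith)]; exact integrableOn_empty
  refine Integrable.mono' h (Measurable.aestronglyMeasurable (by fun_prop)) ?_
  filter_upwards [ae_restrict_mem measurableSet_Ioc] with u hu
  have hu0 : 0 < u := hu.1
  rw [norm_mul, Real.norm_of_nonneg (show 0 ≤ u ^ (-p) by positivity), sub_eq_add_neg,
    Real.rpow_add hu0, Real.rpow_one]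
  gcongr
  have := Real.abs_sin_le_abs (x := u)
  rwa [abs_of_pos hu0] at this

/-- Insert Γ(p) u^{-p} = ∫ s^{p-1} e^{-us} ds and swap. On (0, U] the swap is absolutely convergent
because |sin u| ≤ u and p < 2, and the s-integral then has a U-limit by dominated convergence even
when the sine integral converges only conditionally. -/
lemma gamma_mul_sineIntegral (hp : 0 < p) (hp2 : p < 2) {U : ℝ} (hU : 0 ≤ U) :
    Real.Gamma p * sineIntegral p U = ∫ s in Ioi (0 : ℝ), s ^ (p - 1) *
      ((1 - Real.exp (-(U * s)) * (Real.cos U + s * Real.sin U)) * (1 + s ^ 2)⁻¹) := by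
  have hG : ∀ u : ℝ, 0 < u → ∫ s in Ioi (0 : ℝ), s ^ (p - 1) * Real.exp (-(u * s)) =
      Real.Gamma p * u ^ (-p) := by
    intro u hu
    rw [Real.integral_rpow_mul_exp_neg_mul_Ioi hp hu, one_div, Real.inv_rpow hu.le,
      Real.rpow_neg hu.le, mul_comm]
  have hGi : ∀ u : ℝ, 0 < u →
      IntegrableOn (fun s : ℝ => s ^ (p - 1) * Real.exp (-(u * s))) (Ioi 0) := by
    intro u hu
    have := integrableOn_rpow_mul_exp_neg_mul_rpow (s := p - 1) (p := 1) (b := u) (by linarith)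
      one_pos hu
    simpa using this
  have hI : Integrable (Function.uncurry
      fun u s : ℝ => Real.sin u * (s ^ (p - 1) * Real.exp (-(u * s))))
      ((volume.restrict (Ioc 0 U)).prod (volume.restrict (Ioi 0))) := by
    refine (integrable_prod_iff (Measurable.aestronglyMeasurable ?_)).2 ⟨?_, ?_⟩
    · unfold Function.uncurry; fun_prop
    · filter_upwards [ae_restrict_mem measurableSet_Ioc] with u hu
      exact (hGi u hu.1).const_mul (Real.sin u)
    · refine ((integrableOn_sin_mul_rpow hp2 U).norm.const_mul (Real.Gamma p)).congr ?_
      filter_upwards [ae_restrict_mem measurableSet_Ioc] with u hu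
      have hu0 : 0 < u := hu.1
      have : ∀ s ∈ Ioi (0 : ℝ), ‖Function.uncurry
          (fun u s : ℝ => Real.sin u * (s ^ (p - 1) * Real.exp (-(u * s)))) (u, s)‖ =
          |Real.sin u| * (s ^ (p - 1) * Real.exp (-(u * s))) := by
        intro s hs
        have hs0 : 0 < s := hs
        simp only [Function.uncurry]
        rw [norm_mul, Real.norm_eq_abs, Real.norm_of_nonneg (by positivity)]
      rw [setIntegral_congr_fun measurableSet_Ioi this, integral_const_mul, hG u hu.1, norm_mul,
        Real.norm_eq_abs, Real.norm_of_nonneg (show 0 ≤ u ^ (-p) by positivity)]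
      ring
  have hswap := integral_integral_swap hI
  have e1 : Real.Gamma p * sineIntegral p U = ∫ u in Ioc 0 U, ∫ s in Ioi (0 : ℝ),
      Real.sin u * (s ^ (p - 1) * Real.exp (-(u * s))) := by
    rw [sineIntegral, intervalIntegral.integral_of_le hU, ← integral_const_mul]
    refine setIntegral_congr_fun measurableSet_Ioc fun u hu => ?_
    rw [integral_const_mul, hG u hu.1]
    ring
  rw [e1, hswap]
  refine setIntegral_congr_fun measurableSet_Ioi fun s _ => ?_
  rw [← integral_sin_mul_exp, intervalIntegral.integral_of_le hU, ← integral_const_mul]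
  refine setIntegral_congr_fun measurableSet_Ioc fun u _ => ?_
  ring

/-- For U ≥ 1, e^{Us} ≥ 1 + Us ≥ 1 + s, so the oscillating term is at most 1 uniformly in U. -/
lemma abs_laplace_remainder_le {s U : ℝ} (hs : 0 < s) (hU : 1 ≤ U) :
    |1 - Real.exp (-(U * s)) * (Real.cos U + s * Real.sin U)| ≤ 2 := by
  have h1 : |Real.cos U + s * Real.sin U| ≤ 1 + s := by
    refine (abs_add_le _ _).trans ?_
    rw [abs_mul, abs_of_pos hs]
    have := Real.abs_cos_le_one U
    have := Real.abs_sin_le_one U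
    nlinarith
  have h2 : Real.exp (-(U * s)) * (1 + s) ≤ 1 := by
    rw [Real.exp_neg, inv_mul_le_iff₀ (Real.exp_pos _), mul_one]
    have := Real.add_one_le_exp (U * s)
    nlinarith
  have h3 : |Real.exp (-(U * s)) * (Real.cos U + s * Real.sin U)| ≤ 1 := by
    rw [abs_mul, Real.abs_exp]
    refine le_trans ?_ h2
    gcongr
  refine (abs_sub _ _).trans ?_
  rw [abs_one]
  linarith

lemma norm_laplace_integrand_le {s U : ℝ} (hs : 0 < s) (hU : 1 ≤ U) :
    ‖s ^ (p - 1) * ((1 - Real.exp (-(U * s)) * (Real.cos U + s * Real.sin U)) * (1 + s ^ 2)⁻¹)‖ ≤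
      2 * (s ^ (p - 1) * (1 + s ^ 2)⁻¹) := by
  rw [norm_mul, norm_mul, Real.norm_of_nonneg (show 0 ≤ s ^ (p - 1) by positivity),
    Real.norm_of_nonneg (show 0 ≤ (1 + s ^ 2)⁻¹ by positivity), Real.norm_eq_abs]
  have := abs_laplace_remainder_le hs hU
  calc _ ≤ s ^ (p - 1) * (2 * (1 + s ^ 2)⁻¹) := by gcongr
    _ = _ := by ring

lemma tendsto_sineIntegral (hp : 0 < p) (hp2 : p < 2) :
    Tendsto (sineIntegral p) atTop (𝓝 (sineConst p)) := by
  have hΓ := Real.Gamma_pos_of_pos hp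
  have key : Tendsto (fun U : ℝ => ∫ s in Ioi (0 : ℝ), s ^ (p - 1) *
      ((1 - Real.exp (-(U * s)) * (Real.cos U + s * Real.sin U)) * (1 + s ^ 2)⁻¹)) atTop
      (𝓝 (∫ s in Ioi (0 : ℝ), s ^ (p - 1) * (1 + s ^ 2)⁻¹)) := by
    refine tendsto_integral_filter_of_dominated_convergence
      (fun s => 2 * (s ^ (p - 1) * (1 + s ^ 2)⁻¹)) ?_ ?_
      ((integrableOn_rpow_mul_inv hp hp2).const_mul 2) ?_
    · exact Eventually.of_forall fun U => Measurable.aestronglyMeasurable (by fun_prop)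
    · filter_upwards [eventually_ge_atTop 1] with U hU
      filter_upwards [ae_restrict_mem measurableSet_Ioi] with s hs
      exact norm_laplace_integrand_le hs hU
    · filter_upwards [ae_restrict_mem measurableSet_Ioi] with s hs
      have hs0 : 0 < s := hs
      have h1 : Tendsto (fun U : ℝ => Real.exp (-(U * s)) * (Real.cos U + s * Real.sin U)) atTop
          (𝓝 0) := by
        have h2 : Tendsto (fun U : ℝ => Real.exp (-(U * s)) * (1 + s)) atTop (𝓝 0) := by
          have h3 : Tendsto (fun U : ℝ => Real.exp (-(U * s))) atTop (𝓝 0) :=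
            Real.tendsto_exp_neg_atTop_nhds_zero.comp (tendsto_id.atTop_mul_const hs0)
          simpa using h3.mul_const (1 + s)
        refine squeeze_zero_norm (fun U => ?_) h2
        rw [norm_mul, Real.norm_eq_abs, Real.abs_exp, Real.norm_eq_abs]
        gcongr
        refine (abs_add_le _ _).trans ?_
        rw [abs_mul, abs_of_pos hs0]
        have := Real.abs_cos_le_one U
        have := Real.abs_sin_le_one U
        nlinarith
      have h4 := (((tendsto_const_nhds (x := (1 : ℝ))).sub h1).mul_const ((1 + s ^ 2)⁻¹)).const_mul
        (s ^ (p - 1))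
      simpa using h4
  refine (key.const_mul (Real.Gamma p)⁻¹).congr' ?_
  filter_upwards [eventually_ge_atTop 0] with U hU
  rw [← gamma_mul_sineIntegral hp hp2 hU, inv_mul_cancel_left₀ hΓ.ne']

/-- Uniformity in U supplies the dominating function when the truncation is removed in
`fourierInv_oddSymbol_mul`. -/
lemma exists_abs_sineIntegral_le (hp : 0 < p) (hp2 : p < 2) :
    ∃ B : ℝ, ∀ U, 0 ≤ U → |sineIntegral p U| ≤ B := by
  have hΓ := Real.Gamma_pos_of_pos hp
  have hI := integrableOn_sin_mul_rpow hp2 1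
  refine ⟨max (∫ u in Ioc (0 : ℝ) 1, ‖Real.sin u * u ^ (-p)‖) (2 * sineConst p), fun U hU => ?_⟩
  rcases le_total U 1 with h | h
  · refine le_max_of_le_left ?_
    rw [sineIntegral, intervalIntegral.integral_of_le hU, ← Real.norm_eq_abs]
    refine (norm_integral_le_integral_norm _).trans ?_
    exact setIntegral_mono_set hI.norm (Eventually.of_forall fun _ => norm_nonneg _)
      (Ioc_subset_Ioc_right h).eventuallyLE
  · refine le_max_of_le_right ?_
    have h1 := gamma_mul_sineIntegral hp hp2 hU
    have h2 : |Real.Gamma p * sineIntegral p U| ≤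
        ∫ s in Ioi (0 : ℝ), 2 * (s ^ (p - 1) * (1 + s ^ 2)⁻¹) := by
      rw [h1, ← Real.norm_eq_abs]
      refine norm_integral_le_of_norm_le ((integrableOn_rpow_mul_inv hp hp2).const_mul 2) ?_
      filter_upwards [ae_restrict_mem measurableSet_Ioi] with s hs
      exact norm_laplace_integrand_le hs h
    rw [integral_const_mul, abs_mul, abs_of_pos hΓ] at h2
    rw [sineConst, ← mul_le_mul_iff_right₀ hΓ]
    refine h2.trans (le_of_eq ?_)
    field_simp

lemma integral_sin_mul_rpow_of_pos {a : ℝ} (ha : 0 < a) {T : ℝ} (hT : 0 ≤ T) :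
    ∫ t in (0 : ℝ)..T, Real.sin (a * t) * t ^ (-p) = a ^ (p - 1) * sineIntegral p (a * T) := by
  have h := intervalIntegral.integral_comp_mul_left (a := 0) (b := T)
    (fun u => Real.sin u * u ^ (-p)) ha.ne'
  rw [mul_zero, smul_eq_mul] at h
  have e : ∫ t in (0 : ℝ)..T, Real.sin (a * t) * t ^ (-p) =
      a ^ p * ∫ t in (0 : ℝ)..T, Real.sin (a * t) * (a * t) ^ (-p) := by
    rw [← intervalIntegral.integral_const_mul]
    refine intervalIntegral.integral_congr fun t ht => ?_
    rw [uIcc_of_le hT] at ht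
    rw [Real.mul_rpow ha.le ht.1, Real.rpow_neg ha.le]
    field_simp
  rw [e, h, sineIntegral, Real.rpow_sub_one ha.ne']
  field_simp

lemma integral_sin_mul_rpow (a : ℝ) {T : ℝ} (hT : 0 ≤ T) :
    ∫ t in (0 : ℝ)..T, Real.sin (a * t) * t ^ (-p) =
      Real.sign a * |a| ^ (p - 1) * sineIntegral p (|a| * T) := by
  rcases lt_trichotomy a 0 with h | h | h
  · rw [Real.sign_of_neg h, abs_of_neg h, ← neg_one_mul, neg_one_mul, mul_assoc,
      ← integral_sin_mul_rpow_of_pos (neg_pos.2 h) hT, neg_one_mul,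
      ← intervalIntegral.integral_neg]
    refine intervalIntegral.integral_congr fun t _ => ?_
    simp
  · simp [h]
  · rw [Real.sign_of_pos h, abs_of_pos h, one_mul, integral_sin_mul_rpow_of_pos h hT]

end SineIntegral

/-! ### The singular operator as a Fourier multiplier. -/

/-- A real Schwartz function regarded as a complex one. -/
def complexify (g : 𝓢(ℝ, ℝ)) : 𝓢(ℝ, ℂ) := SchwartzMap.postcompCLM (𝕜 := ℝ) Complex.ofRealCLM g

@[simp]
lemma complexify_apply (g : 𝓢(ℝ, ℝ)) (x : ℝ) : complexify g x = (g x : ℂ) := rfl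

/-- The symbol `i sgn(ω) |ω|^{p-1}` at the angular frequency `ω = 2πξ`. -/
def oddSymbol (p ξ : ℝ) : ℂ :=
  Complex.I * ((Real.sign (2 * Real.pi * ξ) * |2 * Real.pi * ξ| ^ (p - 1) : ℝ) : ℂ)

/-- The power is locally integrable because r > -1, and for |ξ| > 1 it is at most linear because r ≤
1. -/
lemma integrable_abs_rpow_mul_norm {r : ℝ} (hr : -1 < r) (hr1 : r ≤ 1) (G : 𝓢(ℝ, ℂ)) :
    Integrable (fun ξ : ℝ => |2 * Real.pi * ξ| ^ r * ‖G ξ‖) := by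
  have hpi := Real.pi_pos
  obtain ⟨C, hC0, hC⟩ := G.decay 0 0
  simp only [pow_zero, norm_iteratedFDeriv_zero, one_mul] at hC
  have h1 : IntegrableOn (fun ξ : ℝ => |ξ| ^ r) (Ioc 0 1) :=
    (integrableOn_rpow_Ioc hr).congr_fun (fun ξ hξ => by simp [abs_of_pos hξ.1]) measurableSet_Ioc
  have h2 : IntegrableOn (fun ξ : ℝ => |ξ| ^ r) (Ico (-1) 0) := by
    simpa using h1.comp_neg
  have h12 : IntegrableOn (fun ξ : ℝ => (2 * Real.pi) ^ r * C * |ξ| ^ r)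
      (Ico (-1) 0 ∪ Ioc 0 1) := (h2.union h1).const_mul _
  have h3 := h12.integrable_indicator (measurableSet_Ico.union measurableSet_Ioc)
  refine Integrable.mono' (h3.add ((G.integrable_pow_mul volume 1).const_mul (2 * Real.pi))) ?_ ?_
  · have := G.continuous.measurable
    exact Measurable.aestronglyMeasurable (by fun_prop)
  · filter_upwards [Measure.ae_ne volume (0 : ℝ)] with ξ hξ
    rw [Real.norm_of_nonneg (by positivity), Pi.add_apply]
    by_cases h : ξ ∈ Ico (-1) 0 ∪ Ioc 0 1
    · rw [indicator_of_mem h]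
      have e : |2 * Real.pi * ξ| ^ r = (2 * Real.pi) ^ r * |ξ| ^ r := by
        rw [abs_mul, abs_of_pos (by positivity : 0 < 2 * Real.pi),
          Real.mul_rpow (by positivity) (by positivity)]
      rw [e]
      have h5 : (2 * Real.pi) ^ r * |ξ| ^ r * ‖G ξ‖ ≤ (2 * Real.pi) ^ r * |ξ| ^ r * C := by
        gcongr; exact hC ξ
      have h6 : 0 ≤ 2 * Real.pi * (‖ξ‖ ^ 1 * ‖G ξ‖) := by positivity
      linarith
    · rw [indicator_of_notMem h, zero_add]
      have h1 : 1 ≤ |ξ| := by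
        by_contra hlt
        push Not at hlt
        rw [abs_lt] at hlt
        apply h
        rcases lt_or_gt_of_ne hξ with h' | h'
        · exact Or.inl ⟨hlt.1.le, h'⟩
        · exact Or.inr ⟨h', hlt.2.le⟩
      have h2 : 1 ≤ |2 * Real.pi * ξ| := by
        rw [abs_mul, abs_of_pos (by positivity : 0 < 2 * Real.pi)]
        nlinarith [Real.pi_gt_three]
      have h4 : |2 * Real.pi * ξ| ^ r ≤ 2 * Real.pi * |ξ| := by
        calc |2 * Real.pi * ξ| ^ r ≤ |2 * Real.pi * ξ| ^ (1 : ℝ) :=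
              Real.rpow_le_rpow_of_exponent_le h2 hr1
          _ = _ := by rw [Real.rpow_one, abs_mul, abs_of_pos (by positivity : 0 < 2 * Real.pi)]
      rw [pow_one, Real.norm_eq_abs, ← mul_assoc]
      gcongr

lemma abs_sign_le_one (a : ℝ) : |Real.sign a| ≤ 1 := by
  rcases Real.sign_apply_eq a with h | h | h <;> simp [h]

lemma measurable_sign : Measurable Real.sign := by
  unfold Real.sign
  exact Measurable.ite (measurableSet_lt measurable_id measurable_const) measurable_const
    (Measurable.ite (measurableSet_lt measurable_const measurable_id) measurable_const
      measurable_const)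

/-- Rewritten as an integral over the whole line of an indicator on a planar set, so that
measurability in the parameter applies; the absolute value keeps the endpoints ordered. -/
lemma measurable_sineIntegral_abs (p : ℝ) : Measurable (fun U => sineIntegral p |U|) := by
  have e : ∀ U : ℝ, sineIntegral p |U| = ∫ u, {z : ℝ × ℝ | 0 < z.2 ∧ z.2 ≤ |z.1|}.indicator
      (fun z => Real.sin z.2 * z.2 ^ (-p)) (U, u) := by
    intro U
    rw [sineIntegral, intervalIntegral.integral_of_le (abs_nonneg U),
      ← integral_indicator measurableSet_Ioc]
    rfl
  simp only [e]
  have hs : MeasurableSet {z : ℝ × ℝ | 0 < z.2 ∧ z.2 ≤ |z.1|} :=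
    (measurableSet_lt measurable_const measurable_snd).inter
      (measurableSet_le measurable_snd (by fun_prop))
  have hm : Measurable ({z : ℝ × ℝ | 0 < z.2 ∧ z.2 ≤ |z.1|}.indicator
      (fun z => Real.sin z.2 * z.2 ^ (-p))) := Measurable.indicator (by fun_prop) hs
  exact (hm.stronglyMeasurable.integral_prod_right' (ν := volume)).measurable

lemma coe_eq_integral_fourier (g : 𝓢(ℝ, ℝ)) (y : ℝ) :
    (g y : ℂ) = ∫ ξ : ℝ, Complex.exp ((2 * Real.pi * (ξ * y) : ℝ) * Complex.I) *
      (𝓕 (complexify g)) ξ := by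
  have h : (𝓕⁻ (𝓕 (complexify g))) y = complexify g y := by
    rw [FourierTransform.fourierInv_fourier_eq]
  rw [SchwartzMap.fourierInv_coe, Real.fourierInv_eq'] at h
  rw [← complexify_apply, ← h]
  simp [mul_comm]

lemma integrable_exp_mul (G : 𝓢(ℝ, ℂ)) (y : ℝ) :
    Integrable (fun ξ : ℝ => Complex.exp ((2 * Real.pi * (ξ * y) : ℝ) * Complex.I) * G ξ) := by
  refine G.integrable.bdd_mul (c := 1) (Continuous.aestronglyMeasurable (by fun_prop))
    (Eventually.of_forall fun ξ => ?_)
  rw [Complex.norm_exp_ofReal_mul_I]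

lemma coe_sub_eq_integral (g : 𝓢(ℝ, ℝ)) (x t : ℝ) :
    ((g (x + t) - g (x - t) : ℝ) : ℂ) =
      ∫ ξ : ℝ, Complex.exp ((2 * Real.pi * (ξ * x) : ℝ) * Complex.I) *
        (2 * Complex.I * (Real.sin (2 * Real.pi * ξ * t) : ℝ)) * (𝓕 (complexify g)) ξ := by
  rw [Complex.ofReal_sub, coe_eq_integral_fourier, coe_eq_integral_fourier,
    ← integral_sub (integrable_exp_mul _ _) (integrable_exp_mul _ _)]
  refine integral_congr_ae (Eventually.of_forall fun ξ => ?_)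
  simp only
  rw [← sub_mul]
  congr 1
  have e1 : ((2 * Real.pi * (ξ * (x + t)) : ℝ) : ℂ) * Complex.I =
      (2 * Real.pi * (ξ * x) : ℝ) * Complex.I + (2 * Real.pi * ξ * t : ℝ) * Complex.I := by
    push_cast; ring
  have e2 : ((2 * Real.pi * (ξ * (x - t)) : ℝ) : ℂ) * Complex.I =
      (2 * Real.pi * (ξ * x) : ℝ) * Complex.I + -((2 * Real.pi * ξ * t : ℝ) : ℂ) * Complex.I := by
    push_cast; ring
  rw [e1, e2, Complex.exp_add, Complex.exp_add, Complex.ofReal_sin, Complex.sin]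
  ring_nf
  rw [Complex.I_sq]
  ring

/-- The truncated singular integral as an inverse Fourier integral. -/
lemma truncated_singular_eq {p : ℝ} (hp2 : p < 2) (g : 𝓢(ℝ, ℝ)) (x : ℝ) {T : ℝ} (hT : 0 ≤ T) :
    ((∫ t in (0 : ℝ)..T, (g (x + t) - g (x - t)) * t ^ (-p) : ℝ) : ℂ) =
      ∫ ξ : ℝ, Complex.exp ((2 * Real.pi * (ξ * x) : ℝ) * Complex.I) *
        (2 * oddSymbol p ξ * (sineIntegral p (|2 * Real.pi * ξ| * T) : ℝ)) *
          (𝓕 (complexify g)) ξ := by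
  have hpi := Real.pi_pos
  set G := 𝓕 (complexify g) with hG
  have hGm : Measurable G := G.continuous.measurable
  set K : ℝ → ℝ → ℂ := fun t ξ => Complex.exp ((2 * Real.pi * (ξ * x) : ℝ) * Complex.I) *
        (2 * Complex.I * (Real.sin (2 * Real.pi * ξ * t) * t ^ (-p) : ℝ)) * G ξ with hK
  -- The bound |sin(ωt)| ≤ |ω| t leaves t^{1-p}, integrable on (0, T], times a Schwartz tail. The
  -- truncation at T is needed for this absolute convergence.
  have hI : Integrable (Function.uncurry K) ((volume.restrict (Ioc 0 T)).prod volume) := by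
    have h1 : IntegrableOn (fun t : ℝ => t ^ (1 - p)) (Ioc 0 T) := by
      have := intervalIntegral.intervalIntegrable_rpow' (a := 0) (b := T) (r := 1 - p)
        (by linarith)
      rwa [intervalIntegrable_iff_integrableOn_Ioc_of_le hT] at this
    have h2 : Integrable (fun ξ : ℝ => 4 * Real.pi * (‖ξ‖ ^ 1 * ‖G ξ‖)) :=
      (G.integrable_pow_mul volume 1).const_mul _
    have hm : Measurable (Function.uncurry K) := by
      simp only [hK]; unfold Function.uncurry; fun_prop
    refine Integrable.mono' (h1.integrable.mul_prod h2) hm.aestronglyMeasurable ?_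
    have hmem : ∀ᵐ z : ℝ × ℝ ∂((volume.restrict (Ioc 0 T)).prod volume), z.1 ∈ Ioc 0 T :=
      Measure.quasiMeasurePreserving_fst.ae (ae_restrict_mem measurableSet_Ioc)
    filter_upwards [hmem] with z hz
    have ht : 0 < z.1 := hz.1
    have hs : |Real.sin (2 * Real.pi * z.2 * z.1)| ≤ 2 * Real.pi * |z.2| * z.1 := by
      refine Real.abs_sin_le_abs.trans (le_of_eq ?_)
      rw [abs_mul, abs_mul, abs_of_pos ht, abs_of_pos (by positivity : 0 < 2 * Real.pi)]
    simp only [Function.uncurry, hK]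
    rw [norm_mul, norm_mul, Complex.norm_exp_ofReal_mul_I, one_mul, norm_mul, norm_mul,
      Complex.norm_I, Complex.norm_real, norm_mul, Real.norm_eq_abs,
      Real.norm_of_nonneg (show 0 ≤ z.1 ^ (-p) by positivity), sub_eq_add_neg,
      Real.rpow_add ht, Real.rpow_one, pow_one, Real.norm_eq_abs z.2, RCLike.norm_ofNat]
    calc _ ≤ 2 * 1 * (2 * Real.pi * |z.2| * z.1 * z.1 ^ (-p)) * ‖G z.2‖ := by gcongr
      _ = _ := by ring
  have e1 : ((∫ t in (0 : ℝ)..T, (g (x + t) - g (x - t)) * t ^ (-p) : ℝ) : ℂ) =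
      ∫ t in Ioc 0 T, ∫ ξ, K t ξ := by
    rw [intervalIntegral.integral_of_le hT, ← integral_complex_ofReal]
    refine setIntegral_congr_fun measurableSet_Ioc fun t _ => ?_
    rw [Complex.ofReal_mul, show ((g (x + t) - g (x - t) : ℝ) : ℂ) = _ from coe_sub_eq_integral g x t,
      ← integral_mul_const]
    refine integral_congr_ae (Eventually.of_forall fun ξ => ?_)
    simp only [hK]
    push_cast
    ring
  rw [e1, integral_integral_swap hI]
  refine integral_congr_ae (Eventually.of_forall fun ξ => ?_)
  simp only [hK]
  rw [integral_mul_const, integral_const_mul, integral_const_mul]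
  have e2 : ∫ t in Ioc 0 T, ((Real.sin (2 * Real.pi * ξ * t) * t ^ (-p) : ℝ) : ℂ) =
      ((Real.sign (2 * Real.pi * ξ) * |2 * Real.pi * ξ| ^ (p - 1) *
        sineIntegral p (|2 * Real.pi * ξ| * T) : ℝ) : ℂ) := by
    rw [← integral_sin_mul_rpow _ hT, intervalIntegral.integral_of_le hT]
    exact integral_ofReal
  rw [e2, oddSymbol]
  push_cast
  ring


lemma norm_oddSymbol_le (p ξ : ℝ) : ‖oddSymbol p ξ‖ ≤ |2 * Real.pi * ξ| ^ (p - 1) := by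
  rw [oddSymbol, norm_mul, Complex.norm_I, one_mul, Complex.norm_real, norm_mul,
    Real.norm_eq_abs, Real.norm_of_nonneg (by positivity)]
  exact mul_le_of_le_one_left (by positivity) (abs_sign_le_one _)

lemma measurable_oddSymbol (p : ℝ) : Measurable (oddSymbol p) := by
  have := measurable_sign
  unfold oddSymbol
  fun_prop

lemma integrable_oddSymbol_mul {p : ℝ} (hp : 0 < p) (hp2 : p < 2) (G : 𝓢(ℝ, ℂ)) :
    Integrable (fun ξ => oddSymbol p ξ * G ξ) := by
  refine Integrable.mono' (integrable_abs_rpow_mul_norm (r := p - 1) (by linarith) (by linarith) G)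
    ?_ (Eventually.of_forall fun ξ => ?_)
  · exact ((measurable_oddSymbol p).mul G.continuous.measurable).aestronglyMeasurable
  · rw [norm_mul]
    gcongr
    exact norm_oddSymbol_le p ξ

section Schwartz

variable (g : 𝓢(ℝ, ℝ))

lemma SchwartzMap.exists_abs_le : ∃ M, ∀ x, |g x| ≤ M := by
  obtain ⟨C, _, hC⟩ := g.decay 0 0
  exact ⟨C, fun x => by simpa using hC x⟩

lemma SchwartzMap.hasDerivAt_coe (x : ℝ) : HasDerivAt g (deriv g x) x :=
  g.differentiableAt.hasDerivAt

lemma SchwartzMap.exists_abs_deriv_le : ∃ L, ∀ x, |deriv g x| ≤ L :=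
  (SchwartzMap.derivCLM ℝ ℝ g).exists_abs_le

lemma SchwartzMap.integrableOn_singular {p : ℝ} (hp : 0 ≤ p) (hp2 : p < 2) (x : ℝ) :
    IntegrableOn (fun t : ℝ => (g (x + t) - g (x - t)) * t ^ (-p)) (Ioi 0) := by
  obtain ⟨L, hL⟩ := g.exists_abs_deriv_le
  have hm := g.continuous.measurable
  refine Integrable.mono' (integrable_singularBound (L := L) hp2 g.integrable x).integrableOn
    (Measurable.aestronglyMeasurable (by fun_prop)) ?_
  filter_upwards [ae_restrict_mem measurableSet_Ioi] with t ht
  have ht0 : 0 < t := ht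
  rw [norm_mul, Real.norm_eq_abs, Real.norm_of_nonneg (show 0 ≤ t ^ (-p) by positivity)]
  exact abs_integrand_le_singularBound hp g.hasDerivAt_coe hL x ht

/-- The singular integral operator is the Fourier multiplier with symbol `oddSymbol`. -/
theorem fourierInv_oddSymbol_mul {p : ℝ} (hp : 0 < p) (hp2 : p < 2) (x : ℝ) :
    𝓕⁻ (fun ξ : ℝ => oddSymbol p ξ * (𝓕 (complexify g)) ξ) x =
      (((2 * sineConst p)⁻¹ * singularOp p g x : ℝ) : ℂ) := by
  set G := 𝓕 (complexify g) with hG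
  have hGm : Measurable G := G.continuous.measurable
  have hκ := sineConst_pos hp hp2
  obtain ⟨B, hB⟩ := exists_abs_sineIntegral_le hp hp2
  have hB0 : 0 ≤ B := (abs_nonneg _).trans (hB 0 le_rfl)
  have l1 : Tendsto (fun T : ℝ => ((∫ t in (0 : ℝ)..T, (g (x + t) - g (x - t)) * t ^ (-p) : ℝ) : ℂ))
      atTop (𝓝 ((singularOp p g x : ℝ) : ℂ)) :=
    (Complex.continuous_ofReal.tendsto _).comp
      (intervalIntegral_tendsto_integral_Ioi 0 (g.integrableOn_singular hp.le hp2 x) tendsto_id)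
  have l2 : Tendsto (fun T : ℝ => ∫ ξ : ℝ, Complex.exp ((2 * Real.pi * (ξ * x) : ℝ) * Complex.I) *
        (2 * oddSymbol p ξ * (sineIntegral p (|2 * Real.pi * ξ| * T) : ℝ)) * G ξ) atTop
      (𝓝 (∫ ξ : ℝ, Complex.exp ((2 * Real.pi * (ξ * x) : ℝ) * Complex.I) *
        (2 * oddSymbol p ξ * (sineConst p : ℝ)) * G ξ)) := by
    refine tendsto_integral_filter_of_dominated_convergence
      (fun ξ => 2 * B * ‖oddSymbol p ξ * G ξ‖) ?_ ?_
      ((integrable_oddSymbol_mul hp hp2 G).norm.const_mul _) ?_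
    · filter_upwards [eventually_ge_atTop 0] with T hT
      have h1 : Measurable (fun ξ : ℝ => sineIntegral p (|2 * Real.pi * ξ| * T)) := by
        have e : ∀ ξ : ℝ, |2 * Real.pi * ξ| * T = |2 * Real.pi * ξ * T| := fun ξ => by
          rw [abs_mul _ T, abs_of_nonneg hT]
        simp only [e]
        exact (measurable_sineIntegral_abs p).comp (by fun_prop)
      have h2 := measurable_oddSymbol p
      exact Measurable.aestronglyMeasurable (by fun_prop)
    · filter_upwards [eventually_ge_atTop 0] with T hT
      refine Eventually.of_forall fun ξ => ?_
      rw [norm_mul, norm_mul, Complex.norm_exp_ofReal_mul_I, one_mul, norm_mul, norm_mul,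
        Complex.norm_real, Real.norm_eq_abs, RCLike.norm_ofNat, norm_mul]
      have := hB (|2 * Real.pi * ξ| * T) (by positivity)
      calc _ ≤ 2 * ‖oddSymbol p ξ‖ * B * ‖G ξ‖ := by gcongr
        _ = _ := by ring
    · filter_upwards [Measure.ae_ne volume (0 : ℝ)] with ξ hξ
      have ha : 0 < |2 * Real.pi * ξ| := abs_pos.2 (by positivity)
      have h1 : Tendsto (fun T : ℝ => sineIntegral p (|2 * Real.pi * ξ| * T)) atTop
          (𝓝 (sineConst p)) :=
        (tendsto_sineIntegral hp hp2).comp (tendsto_id.const_mul_atTop ha)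
      have h2 := (Complex.continuous_ofReal.tendsto _).comp h1
      exact ((h2.const_mul _).const_mul _).mul_const _
  have l3 := l2.congr' (f₂ := fun T : ℝ =>
      ((∫ t in (0 : ℝ)..T, (g (x + t) - g (x - t)) * t ^ (-p) : ℝ) : ℂ)) (by
    filter_upwards [eventually_ge_atTop 0] with T hT
    exact (truncated_singular_eq hp2 g x hT).symm)
  have e := tendsto_nhds_unique l1 l3
  rw [Complex.ofReal_mul, e, Real.fourierInv_eq', ← integral_const_mul]
  refine integral_congr_ae (Eventually.of_forall fun ξ => ?_)
  have hκ' : (sineConst p : ℂ) ≠ 0 := by exact_mod_cast hκ.ne'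
  simp only [smul_eq_mul, RCLike.inner_apply, conj_trivial]
  push_cast
  field_simp

end Schwartz

/-! ### Inverse Fourier transforms on L¹ ∩ L². -/

lemma continuous_neg_innerₗ :
    Continuous fun z : ℝ × ℝ => (-innerₗ ℝ : ℝ →ₗ[ℝ] ℝ →ₗ[ℝ] ℝ) z.1 z.2 := by
  simp only [LinearMap.neg_apply, innerₗ_apply_apply]
  fun_prop

lemma continuous_fourierInv {φ : ℝ → ℂ} (hφ : Integrable φ) : Continuous (𝓕⁻ φ) := by
  have h := VectorFourier.fourierIntegral_continuous (μ := (volume : Measure ℝ))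
    (L := -innerₗ ℝ) Real.continuous_fourierChar
    continuous_neg_innerₗ hφ
  exact h

lemma integral_fourierInv_mul_comm {φ ψ : ℝ → ℂ} (hφ : Integrable φ) (hψ : Integrable ψ) :
    ∫ x, 𝓕⁻ ψ x * φ x = ∫ x, ψ x * 𝓕⁻ φ x := by
  have h := VectorFourier.integral_fourierIntegral_smul_eq_flip (μ := (volume : Measure ℝ))
    (ν := (volume : Measure ℝ)) (L := -innerₗ ℝ) Real.continuous_fourierChar
    continuous_neg_innerₗ hψ hφ
  have hflip : (-innerₗ ℝ : ℝ →ₗ[ℝ] ℝ →ₗ[ℝ] ℝ).flip = -innerₗ ℝ := by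
    ext; simp
  rw [hflip] at h
  exact h

/-- On `L¹ ∩ L²` the inverse Fourier integral agrees with the `L²` inverse Fourier transform. -/
lemma coeFn_fourierInv_toLp {φ : ℝ → ℂ} (h1 : Integrable φ) (h2 : MemLp φ 2) :
    ((𝓕⁻ (h2.toLp φ) : Lp ℂ 2 (volume : Measure ℝ)) : ℝ → ℂ) =ᵐ[volume] 𝓕⁻ φ := by
  -- Both sides are tested against smooth compactly supported functions, viewed as Schwartz
  -- functions, where the L² transform is given by duality.
  refine ae_eq_of_integral_contDiff_smul_eq
    ((Lp.memLp _).locallyIntegrable (by norm_num))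
    (continuous_fourierInv h1).locallyIntegrable fun χ hχ hχc => ?_
  have hc₁ : HasCompactSupport (Complex.ofRealCLM ∘ χ) := hχc.comp_left rfl
  have hc₂ : ContDiff ℝ (⊤ : ℕ∞) (Complex.ofRealCLM ∘ χ) := by fun_prop
  set ψ : 𝓢(ℝ, ℂ) := hc₁.toSchwartzMap hc₂
  have hψ : ∀ x, ψ x = (χ x : ℂ) := fun x => rfl
  have key := congrArg (fun D : 𝓢'(ℝ, ℂ) => D ψ)
    (Lp.fourierInv_toTemperedDistribution_eq (h2.toLp φ))
  simp only [TemperedDistribution.fourierInv_apply, Lp.toTemperedDistribution_apply] at key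
  have e1 : ∫ x, (𝓕⁻ ψ) x • (h2.toLp φ) x = ∫ x, 𝓕⁻ (ψ : ℝ → ℂ) x * φ x := by
    refine integral_congr_ae ?_
    filter_upwards [h2.coeFn_toLp] with x hx
    rw [hx, smul_eq_mul, SchwartzMap.fourierInv_coe]
  rw [e1, integral_fourierInv_mul_comm h1 ψ.integrable] at key
  simp only [hψ, smul_eq_mul] at key
  simpa using key.symm

lemma memLp_fourierInv {φ : ℝ → ℂ} (h1 : Integrable φ) (h2 : MemLp φ 2) : MemLp (𝓕⁻ φ) 2 :=
  (Lp.memLp _).ae_eq (coeFn_fourierInv_toLp h1 h2)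

/-- Needed for the Hilbert transform, which need not be Schwartz but is an inverse Fourier integral
with a symbol in L¹ ∩ L². -/
lemma fourier_toLp_fourierInv {φ : ℝ → ℂ} (h1 : Integrable φ) (h2 : MemLp φ 2)
    (h3 : MemLp (𝓕⁻ φ) 2) :
    (𝓕 (h3.toLp (𝓕⁻ φ)) : Lp ℂ 2 (volume : Measure ℝ)) = h2.toLp φ := by
  have e : h3.toLp (𝓕⁻ φ) = 𝓕⁻ (h2.toLp φ) :=
    Lp.ext (h3.coeFn_toLp.trans (coeFn_fourierInv_toLp h1 h2).symm)
  rw [e, FourierTransform.fourier_fourierInv_eq]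

lemma fourierInv_congr_ae {φ ψ : ℝ → ℂ} (h : φ =ᵐ[volume] ψ) (x : ℝ) : 𝓕⁻ φ x = 𝓕⁻ ψ x := by
  rw [Real.fourierInv_eq', Real.fourierInv_eq']
  refine integral_congr_ae ?_
  filter_upwards [h] with ξ hξ
  rw [hξ]

/-! ### Identification of the two operators with the singular integral. -/

section Operators

variable (g : 𝓢(ℝ, ℝ))

lemma fourier_complexify_deriv (ξ : ℝ) :
    (𝓕 (SchwartzMap.derivCLM ℂ ℂ (complexify g))) ξ =
      2 * Real.pi * Complex.I * ξ * (𝓕 (complexify g)) ξ := by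
  set G := complexify g
  have h := Real.fourier_deriv G.integrable G.differentiable
    (SchwartzMap.derivCLM ℂ ℂ G).integrable
  have h2 := congrFun h ξ
  rw [SchwartzMap.fourier_coe, SchwartzMap.fourier_coe]
  rw [show ⇑(SchwartzMap.derivCLM ℂ ℂ G) = deriv G from
    funext fun x => SchwartzMap.derivCLM_apply ℂ G x]
  simpa only [smul_eq_mul] using h2

lemma coe_deriv (x : ℝ) :
    ((deriv g x : ℝ) : ℂ) = SchwartzMap.derivCLM ℂ ℂ (complexify g) x := by
  rw [SchwartzMap.derivCLM_apply]
  have h : HasDerivAt (complexify g) ((deriv g x : ℝ) : ℂ) x :=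
    (g.hasDerivAt_coe x).ofReal_comp
  exact h.deriv.symm

/-- Multiplying symbols: |ω|^{-α} · iω = i sgn(ω) |ω|^{(2-α)-1} for ω ≠ 0. -/
theorem lambdaPow_deriv {α : ℝ} (hα : 0 < α) (hα2 : α < 2) (x : ℝ) :
    lambdaPow (-α) (deriv g) x = (2 * sineConst (2 - α))⁻¹ * singularOp (2 - α) g x := by
  set D := SchwartzMap.derivCLM ℂ ℂ (complexify g) with hD
  have hfun : (fun y : ℝ => ((deriv g y : ℝ) : ℂ)) = D := funext fun y => coe_deriv g y
  have hmem : MemLp (fun y : ℝ => ((deriv g y : ℝ) : ℂ)) 2 volume := by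
    rw [hfun]; exact D.memLp 2
  rw [lambdaPow, dif_pos hmem]
  have e : hmem.toLp (fun y : ℝ => ((deriv g y : ℝ) : ℂ)) = D.toLp 2 := by
    refine Lp.ext (hmem.coeFn_toLp.trans ?_)
    rw [hfun]
    exact (D.coeFn_toLp 2).symm
  rw [e, SchwartzMap.toLp_fourier_eq]
  have key : (fun ξ : ℝ => ((|2 * Real.pi * ξ| ^ (-α) : ℝ) : ℂ) * ((𝓕 D).toLp 2) ξ) =ᵐ[volume]
      fun ξ => oddSymbol (2 - α) ξ * (𝓕 (complexify g)) ξ := by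
    filter_upwards [(𝓕 D).coeFn_toLp 2, Measure.ae_ne volume (0 : ℝ)] with ξ hξ hξ0
    rw [hξ, hD, fourier_complexify_deriv, oddSymbol]
    have ha : 2 * Real.pi * ξ ≠ 0 := by positivity
    set a := 2 * Real.pi * ξ with hadef
    have hreal : Real.sign a * |a| ^ (2 - α - 1) = |a| ^ (-α) * a := by
      rw [show 2 - α - 1 = -α + 1 by ring, Real.rpow_add (abs_pos.2 ha), Real.rpow_one]
      have : Real.sign a * |a| = a := by
        rcases lt_or_gt_of_ne ha with h | h
        · rw [Real.sign_of_neg h, abs_of_neg h]; ring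
        · rw [Real.sign_of_pos h, abs_of_pos h]; ring
      linear_combination |a| ^ (-α) * this
    rw [hreal, hadef]
    push_cast
    ring
  rw [fourierInv_congr_ae key, fourierInv_oddSymbol_mul g (by linarith) (by linarith),
    Complex.ofReal_re]

lemma setIntegral_hilbert (x : ℝ) {ε : ℝ} (hε : 0 < ε) :
    ∫ y in {y : ℝ | ε < |x - y|}, g y / (x - y) =
      -∫ t in Ioi ε, (g (x + t) - g (x - t)) * t ^ (-(1 : ℝ)) := by
  have hset : {y : ℝ | ε < |x - y|} = Ioi (x + ε) ∪ Iio (x - ε) := by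
    ext y
    simp only [mem_ofPred_eq, mem_union, mem_Ioi, mem_Iio, lt_abs]
    constructor
    · rintro (h | h)
      · right; linarith
      · left; linarith
    · rintro (h | h)
      · right; linarith
      · left; linarith
  have hI : IntegrableOn (fun y => g y / (x - y)) {y : ℝ | ε < |x - y|} := by
    have hm := g.continuous.measurable
    refine Integrable.mono' (g.integrable.norm.const_mul ε⁻¹).integrableOn
      (Measurable.aestronglyMeasurable (by fun_prop)) ?_
    have hms : MeasurableSet {y : ℝ | ε < |x - y|} :=
      measurableSet_lt measurable_const (by fun_prop)
    filter_upwards [ae_restrict_mem hms] with y hy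
    have hy' : ε < |x - y| := hy
    rw [norm_div, div_eq_inv_mul, Real.norm_eq_abs (x - y)]
    gcongr
  rw [hset] at hI ⊢
  rw [setIntegral_union (by
      rw [Set.disjoint_left]; intro y h1 h2; simp only [mem_Ioi, mem_Iio] at h1 h2; linarith)
    measurableSet_Iio (hI.mono_set subset_union_left) (hI.mono_set subset_union_right)]
  have a1 : ∫ y in Ioi (x + ε), g y / (x - y) = ∫ t in Ioi ε, -(g (x + t) * t ^ (-(1 : ℝ))) := by
    rw [← setIntegral_Ioi_add_left]
    refine setIntegral_congr_fun measurableSet_Ioi fun t _ => ?_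
    rw [Real.rpow_neg_one, show x - (x + t) = -t by ring, div_neg, div_eq_mul_inv]
  have a2 : ∫ y in Iio (x - ε), g y / (x - y) = ∫ t in Ioi ε, g (x - t) * t ^ (-(1 : ℝ)) := by
    have h := (Measure.measurePreserving_sub_left (volume : Measure ℝ) x).setIntegral_preimage_emb
      (measurableEmbedding_subLeft x) (fun y => g y / (x - y)) (Iio (x - ε))
    rw [← h]
    have : (fun t => x - t) ⁻¹' Iio (x - ε) = Ioi ε := by ext t; simp
    rw [this]
    refine setIntegral_congr_fun measurableSet_Ioi fun t _ => ?_
    rw [Real.rpow_neg_one, show x - (x - t) = t by ring, div_eq_mul_inv]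
  have hbd : ∀ t ∈ Ioi ε, ‖t ^ (-(1 : ℝ))‖ ≤ ε⁻¹ := by
    intro t ht
    have ht0 : 0 < t := hε.trans ht
    rw [Real.rpow_neg_one, norm_inv, Real.norm_of_nonneg ht0.le]
    exact inv_anti₀ hε (le_of_lt ht)
  have i1 : IntegrableOn (fun t => g (x + t) * t ^ (-(1 : ℝ))) (Ioi ε) := by
    refine (g.integrable.comp_add_left x).integrableOn.mul_bdd (c := ε⁻¹)
      (Measurable.aestronglyMeasurable (by fun_prop)) ?_
    filter_upwards [ae_restrict_mem measurableSet_Ioi] with t ht using hbd t ht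
  have i2 : IntegrableOn (fun t => g (x - t) * t ^ (-(1 : ℝ))) (Ioi ε) := by
    refine (g.integrable.comp_sub_left x).integrableOn.mul_bdd (c := ε⁻¹)
      (Measurable.aestronglyMeasurable (by fun_prop)) ?_
    filter_upwards [ae_restrict_mem measurableSet_Ioi] with t ht using hbd t ht
  rw [a1, a2, integral_neg, ← sub_eq_neg_add, ← neg_sub, ← integral_sub i1 i2]
  simp only [sub_mul]

/-- Pairing y = x + t with y = x - t turns the truncated integrals into those of an absolutely
integrable function, so the principal value exists. The sign comes from x - y = -t on the right
half. -/
theorem hilbertTransform_eq (x : ℝ) :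
    hilbertTransform g x = -(Real.pi⁻¹ * singularOp 1 g x) := by
  have hI := g.integrableOn_singular (p := 1) zero_le_one one_lt_two x
  have hlim : Tendsto (fun ε : ℝ => ∫ y in {y : ℝ | ε < |x - y|}, g y / (x - y)) (𝓝[>] 0)
      (𝓝 (-singularOp 1 g x)) := by
    have h1 : Tendsto (fun ε : ℝ => ∫ t in Ioi (0 : ℝ), (Ioi ε).indicator
        (fun t => (g (x + t) - g (x - t)) * t ^ (-(1 : ℝ))) t) (𝓝[>] 0)
        (𝓝 (singularOp 1 g x)) := by
      refine tendsto_integral_filter_of_dominated_convergence _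
        (Eventually.of_forall fun ε => ?_)
        (Eventually.of_forall fun ε => Eventually.of_forall fun t =>
          norm_indicator_le_norm_self _ _) hI.norm ?_
      · exact hI.aestronglyMeasurable.indicator measurableSet_Ioi
      · filter_upwards [ae_restrict_mem measurableSet_Ioi] with t ht
        refine tendsto_const_nhds.congr' ?_
        have : ∀ᶠ ε in 𝓝[>] (0 : ℝ), ε < t := nhdsWithin_le_nhds (eventually_lt_nhds ht)
        filter_upwards [this] with ε hε
        rw [indicator_of_mem (mem_Ioi.2 hε)]
    refine h1.neg.congr' ?_
    filter_upwards [self_mem_nhdsWithin] with ε hε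
    rw [setIntegral_hilbert g x hε, setIntegral_indicator measurableSet_Ioi,
      inter_eq_self_of_subset_right (Ioi_subset_Ioi (le_of_lt hε))]
  rw [hilbertTransform, hlim.limUnder_eq]
  ring

/-- H has the symbol -i sgn(ω), so Λ^{-(α-1)} H has minus the symbol of the singular operator with p
= 2 - α. -/
theorem lambdaPow_hilbertTransform {α : ℝ} (hα : 1 ≤ α) (hα2 : α < 2) (x : ℝ) :
    lambdaPow (-(α - 1)) (hilbertTransform g) x =
      -((2 * sineConst (2 - α))⁻¹ * singularOp (2 - α) g x) := by
  set G := 𝓕 (complexify g) with hG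
  set φ : ℝ → ℂ := fun ξ => oddSymbol 1 ξ * (-G) ξ with hφ
  have h1 : Integrable φ := integrable_oddSymbol_mul one_pos one_lt_two (-G)
  have h2 : MemLp φ 2 := by
    refine ((-G).memLp 2).of_le h1.aestronglyMeasurable (Eventually.of_forall fun ξ => ?_)
    rw [hφ, norm_mul]
    refine mul_le_of_le_one_left (norm_nonneg _) ?_
    simpa using norm_oddSymbol_le 1 ξ
  have hfun : (fun y : ℝ => ((hilbertTransform g y : ℝ) : ℂ)) = 𝓕⁻ φ := by
    funext y
    have h := fourierInv_oddSymbol_mul g one_pos one_lt_two y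
    have e : 𝓕⁻ φ y = -𝓕⁻ (fun ξ => oddSymbol 1 ξ * G ξ) y := by
      rw [Real.fourierInv_eq', Real.fourierInv_eq', ← integral_neg]
      simp [hφ]
    -- The value π/2 of the Dirichlet integral matches (2 κ_1)⁻¹ with the factor 1/π of the Hilbert
    -- transform.
    rw [e, h, hilbertTransform_eq, sineConst_one]
    push_cast
    congr 2
    field_simp
  have h3 : MemLp (𝓕⁻ φ) 2 := memLp_fourierInv h1 h2
  have hmem : MemLp (fun y : ℝ => ((hilbertTransform g y : ℝ) : ℂ)) 2 volume := by
    rw [hfun]; exact h3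
  rw [lambdaPow, dif_pos hmem]
  have e : hmem.toLp (fun y : ℝ => ((hilbertTransform g y : ℝ) : ℂ)) = h3.toLp (𝓕⁻ φ) := by
    congr
  rw [e, fourier_toLp_fourierInv h1 h2 h3]
  have key : (fun ξ : ℝ => ((|2 * Real.pi * ξ| ^ (-(α - 1)) : ℝ) : ℂ) * (h2.toLp φ) ξ) =ᵐ[volume]
      fun ξ => -(oddSymbol (2 - α) ξ * G ξ) := by
    filter_upwards [h2.coeFn_toLp] with ξ hξ
    rw [hξ, hφ]
    simp only [oddSymbol, neg_apply]
    rw [show (1 : ℝ) - 1 = 0 by ring, Real.rpow_zero, show 2 - α - 1 = -(α - 1) by ring]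
    push_cast
    ring
  have e2 : 𝓕⁻ (fun ξ => -(oddSymbol (2 - α) ξ * G ξ)) x =
      -𝓕⁻ (fun ξ => oddSymbol (2 - α) ξ * G ξ) x := by
    rw [Real.fourierInv_eq', Real.fourierInv_eq', ← integral_neg]
    simp
  rw [fourierInv_congr_ae key, e2, fourierInv_oddSymbol_mul g (by linarith) (by linarith),
    Complex.neg_re, Complex.ofReal_re]

end Operators

/-! ### Coercivity for even Schwartz functions and conclusion. -/

lemma measurable_singularOp {p : ℝ} {g : ℝ → ℝ} (hgm : Measurable g) :
    Measurable (singularOp p g) := by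
  have h : Measurable (fun z : ℝ × ℝ => (g (z.1 + z.2) - g (z.1 - z.2)) * z.2 ^ (-p)) := by
    fun_prop
  exact (h.stronglyMeasurable.integral_prod_right' (ν := volume.restrict (Ioi 0))).measurable

lemma abs_singularOp_le {p L : ℝ} {g g' : ℝ → ℝ} (hp : 0 ≤ p) (hp2 : p < 2)
    (hg : ∀ x, HasDerivAt g (g' x) x) (hL : ∀ x, |g' x| ≤ L) (hgi : Integrable g) (x : ℝ) :
    |singularOp p g x| ≤ singularMass p L g := by
  refine le_trans ?_ (setIntegral_singularBound_le hp2 ((abs_nonneg _).trans (hL 0)) hgi x)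
  rw [← Real.norm_eq_abs, singularOp]
  refine norm_integral_le_of_norm_le (integrable_singularBound hp2 hgi x).integrableOn ?_
  filter_upwards [ae_restrict_mem measurableSet_Ioi] with t ht
  have ht0 : 0 < t := ht
  rw [norm_mul, Real.norm_eq_abs, Real.norm_of_nonneg (show 0 ≤ t ^ (-p) by positivity)]
  exact abs_integrand_le_singularBound hp hg hL x ht

lemma SchwartzMap.exists_abs_deriv_le_mul {g : 𝓢(ℝ, ℝ)} (hev : Function.Even g) :
    ∃ L, ∀ x, |deriv g x| ≤ L * |x| := by
  have h0 : deriv g 0 = 0 := by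
    have h1 : HasDerivAt (fun x => g (-x)) (-deriv g 0) 0 := by
      have h := (g.hasDerivAt_coe (-0)).comp (0 : ℝ) (hasDerivAt_neg (0 : ℝ))
      simpa [Function.comp_def] using h
    have h2 : (fun x => g (-x)) = g := funext hev
    rw [h2] at h1
    have := h1.unique (g.hasDerivAt_coe 0)
    linarith
  obtain ⟨L, hL⟩ := (SchwartzMap.derivCLM ℝ ℝ g).exists_abs_deriv_le
  refine ⟨L, fun x => ?_⟩
  have h := abs_sub_le_of_deriv (SchwartzMap.derivCLM ℝ ℝ g).hasDerivAt_coe hL x 0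
  simpa [SchwartzMap.derivCLM_apply, h0] using h

/-- The coercivity estimate for even Schwartz functions. -/
theorem singularOp_coercive {α : ℝ} (hα : 0 < α) (hα2 : α < 2) {g : 𝓢(ℝ, ℝ)}
    (hev : Function.Even g) :
    IntegrableOn (fun x : ℝ => (2 * sineConst (2 - α))⁻¹ * singularOp (2 - α) g x * deriv g x / x *
      Real.exp (-x)) (Ioi 0) ∧
    IntegrableOn (fun x : ℝ => (g 0 - g x) ^ 2 / x ^ (3 - α)) (Ioi 0) ∧
    (∫ x in Ioi (0 : ℝ), (2 * sineConst (2 - α))⁻¹ * singularOp (2 - α) g x * deriv g x / x *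
      Real.exp (-x)) ≥
      (2 * sineConst (2 - α))⁻¹ * (2 - α) * (∫ x in Ioi (0 : ℝ), (g 0 - g x) ^ 2 / x ^ (3 - α)) -
        ((2 * sineConst (2 - α))⁻¹ * (errorConst (2 - α) * errorMass (2 - α)) + 1) *
          (⨆ x : ℝ, |g x|) ^ 2 := by
  set p := 2 - α with hpdef
  have hp : 0 < p := by linarith
  have hp2 : p < 2 := by linarith
  set c := (2 * sineConst p)⁻¹ with hc
  have hc0 : 0 < c := by have := sineConst_pos hp hp2; positivity
  obtain ⟨M₀, hM₀⟩ := g.exists_abs_le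
  obtain ⟨L, hL⟩ := g.exists_abs_deriv_le
  obtain ⟨L₂, hL₂⟩ := SchwartzMap.exists_abs_deriv_le_mul hev
  have hM : ∀ x, |g x| ≤ ⨆ x : ℝ, |g x| := fun x =>
    le_ciSup (f := fun x => |g x|) ⟨M₀, by rintro _ ⟨y, rfl⟩; exact hM₀ y⟩ x
  set M := ⨆ x : ℝ, |g x|
  have hg'm : Measurable (deriv g) := measurable_deriv g
  have hgm : Measurable g := g.continuous.measurable
  have e1 : ∀ x : ℝ, c * singularOp p g x * deriv g x / x * Real.exp (-x) =
      c * (weight x * deriv g x * singularOp p g x) := fun x => by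
    unfold weight; ring
  have e2 : ∀ x ∈ Ioi (0 : ℝ), (g 0 - g x) ^ 2 * x ^ (-(p + 1)) = (g 0 - g x) ^ 2 / x ^ (3 - α) := by
    intro x hx
    rw [Real.rpow_neg (le_of_lt hx), div_eq_mul_inv, show p + 1 = 3 - α by rw [hpdef]; ring]
  have I1 : IntegrableOn (fun x => weight x * deriv g x * singularOp p g x) (Ioi 0) := by
    refine Integrable.mono' ((integrableOn_exp_neg.const_mul L₂).mul_const (singularMass p L g))
      ((measurable_weight.mul hg'm).mul (measurable_singularOp hgm)).aestronglyMeasurable ?_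
    filter_upwards [ae_restrict_mem measurableSet_Ioi] with x hx
    have hw := weight_mul_abs_le hL₂ hx
    have hr := abs_singularOp_le hp.le hp2 g.hasDerivAt_coe hL g.integrable x
    have h0 : 0 ≤ weight x * |deriv g x| := mul_nonneg (weight_pos hx).le (abs_nonneg _)
    rw [Real.norm_eq_abs, abs_mul, abs_mul, abs_of_pos (weight_pos hx)]
    exact mul_le_mul hw hr (abs_nonneg _) (h0.trans hw)
  have I2 := integrableOn_sq_mul_rpow hp hp2 g.hasDerivAt_coe hM hL
  have main := integral_weight_mul_singularOp_ge hp hp2 g.hasDerivAt_coe hg'm hM hL hev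
    g.integrable hL₂
  rw [setIntegral_congr_fun measurableSet_Ioi e2] at main
  simp only [e1]
  refine ⟨I1.const_mul c, I2.congr_fun e2 measurableSet_Ioi, ?_⟩
  rw [integral_const_mul, ge_iff_le]
  have h := mul_le_mul_of_nonneg_left main hc0.le
  refine le_trans ?_ h
  -- The summand 1 in the constant only gives away M²; it makes the constant strictly positive
  -- although `errorMass` is only known to be nonnegative.
  nlinarith [sq_nonneg M]

end

theorem lemma5p2 :
    (∀ α : ℝ, 0 < α → α < 1 →
      ∃ C₁ C₂ : ℝ, 0 < C₁ ∧ 0 < C₂ ∧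
        ∀ g : 𝓢(ℝ, ℝ), Function.Even g →
          IntegrableOn
            (fun x : ℝ => lambdaPow (-α) (deriv g) x * deriv g x / x * Real.exp (-x)) (Ioi 0) ∧
          IntegrableOn (fun x : ℝ => (g 0 - g x) ^ 2 / x ^ (3 - α)) (Ioi 0) ∧
          (∫ x in Ioi (0 : ℝ), lambdaPow (-α) (deriv g) x * deriv g x / x * Real.exp (-x)) ≥
            C₁ * (∫ x in Ioi (0 : ℝ), (g 0 - g x) ^ 2 / x ^ (3 - α))
              - C₂ * (⨆ x : ℝ, |g x|) ^ 2) ∧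
    (∀ α : ℝ, 1 ≤ α → α < 2 →
      ∃ C₃ C₄ : ℝ, 0 < C₃ ∧ 0 < C₄ ∧
        ∀ g : 𝓢(ℝ, ℝ), Function.Even g →
          IntegrableOn
            (fun x : ℝ => lambdaPow (-(α - 1)) (hilbertTransform g) x * deriv g x / x
              * Real.exp (-x)) (Ioi 0) ∧
          IntegrableOn (fun x : ℝ => (g 0 - g x) ^ 2 / x ^ (3 - α)) (Ioi 0) ∧
          -(∫ x in Ioi (0 : ℝ), lambdaPow (-(α - 1)) (hilbertTransform g) x * deriv g x / x
              * Real.exp (-x)) ≥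
            C₃ * (∫ x in Ioi (0 : ℝ), (g 0 - g x) ^ 2 / x ^ (3 - α))
              - C₄ * (⨆ x : ℝ, |g x|) ^ 2) := by
  have hpos : ∀ α : ℝ, 0 < α → α < 2 → 0 < (2 * sineConst (2 - α))⁻¹ * (2 - α) ∧
      0 < (2 * sineConst (2 - α))⁻¹ * (errorConst (2 - α) * errorMass (2 - α)) + 1 := by
    intro α h0 h2
    have h1 := sineConst_pos (p := 2 - α) (by linarith) (by linarith)
    have h3 := errorConst_nonneg (p := 2 - α) (by linarith)
    have h4 := errorMass_nonneg (p := 2 - α)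
    have h5 : 0 < 2 - α := by linarith
    exact ⟨by positivity, by positivity⟩
  refine ⟨fun α h0 h1 => ?_, fun α h1 h2 => ?_⟩
  -- The witnesses are read off from `hpos` by unification; they depend on α alone.
  · refine ⟨_, _, (hpos α h0 (by linarith)).1, (hpos α h0 (by linarith)).2, fun g hg => ?_⟩
    simp only [lambdaPow_deriv g h0 (show α < 2 by linarith)]
    exact singularOp_coercive h0 (by linarith) hg
  · refine ⟨_, _, (hpos α (by linarith) h2).1, (hpos α (by linarith) h2).2, fun g hg => ?_⟩
    simp only [lambdaPow_hilbertTransform g h1 h2]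
    obtain ⟨i1, i2, h⟩ := singularOp_coercive (show 0 < α by linarith) h2 hg
    simp only [neg_mul, neg_div, integral_neg, neg_neg]
    exact ⟨i1.neg, i2, h⟩
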